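/- All graphs are finite. An oriented graph is a directed graph without loops and without opposite arcs. Pushing a vertex of an oriented graph means reversing all arcs incident with it. A pushable homomorphism from an oriented graph $\overrightarrow{G}$ to an oriented graph $\overrightarrow{H}$ is a map $V(\overrightarrow{G}) \to V(\overrightarrow{H})$ that sends arcs to arcs after some vertices of $\overrightarrow{G}$ have been pushed. The pushable chromatic number $\chi_p(\overrightarrow{G})$ is the minimum number of vertices of an oriented graph $\overrightarrow{H}$ such that there is a pushable homomorphism from $\overrightarrow{G}$ to $\overrightarrow{H}$. For an undirected simple graph $G$, $\chi_p(G)$ is the maximum of $\chi_p(\overrightarrow{G})$ over all orientations $\overrightarrow{G}$ of $G$; for a family $\mathcal{F}$ of undirected graphs, $\chi_p(\mathcal{F}) = \max\{\chi_p(G) : G \in \mathcal{F}\}$. Theorem. Let $\mathcal{P}_6$ be the family of planar graphs of girth at least $6$ (acyclic graphs having infinite girth). Then the maximum $\chi_p(\mathcal{P}_6)$ exists and $$4 \le \chi_p(\mathcal{P}_6) \le 7.$$ -/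

import Mathlib

namespace PushColoring

/-- An oriented graph: a directed graph without loops and without opposite arcs
(asymmetry of the arc relation excludes both). -/
@[ext]
structure OrientedGraph (V : Type) extends Digraph V where
  asymm : ∀ u v : V, Adj u v → ¬ Adj v u

namespace OrientedGraph

/-- The underlying undirected simple graph. -/
def underlying {V : Type} (O : OrientedGraph V) : SimpleGraph V where
  Adj u v := O.Adj u v ∨ O.Adj v u
  symm := ⟨fun _ _ h => h.symm⟩
  loopless := ⟨fun v h => h.elim (fun h => O.asymm v v h h) (fun h => O.asymm v v h h)⟩

/-- `O` is an orientation of `G`. -/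
def IsOrientationOf {V : Type} (O : OrientedGraph V) (G : SimpleGraph V) : Prop :=
  O.underlying = G

/-- Pushing the vertex `v`: all arcs incident with `v` are reversed, all others are kept. -/
def push {V : Type} (O : OrientedGraph V) (v : V) : OrientedGraph V where
  Adj a b := ((a = v ∨ b = v) ∧ O.Adj b a) ∨ (¬ (a = v ∨ b = v) ∧ O.Adj a b)
  asymm := by
    intro a b h h'
    have h₁ := O.asymm a b
    have h₂ := O.asymm b a
    tauto

/-- `O` and `O'` are in a push relationship: `O'` is obtained from `O` by successively pushing
finitely many vertices. -/
def PushRel {V : Type} (O O' : OrientedGraph V) : Prop :=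
  Relation.ReflTransGen (fun A B : OrientedGraph V => ∃ v : V, B = A.push v) O O'

/-- `φ` is a homomorphism of oriented graphs: it maps arcs to arcs. -/
def IsHom {V W : Type} (O : OrientedGraph V) (H : OrientedGraph W) (φ : V → W) : Prop :=
  ∀ u v : V, O.Adj u v → H.Adj (φ u) (φ v)

/-- `φ` is a pushable homomorphism: a homomorphism from some `O'` in the push class of `O`. -/
def IsPushHom {V W : Type} (O : OrientedGraph V) (H : OrientedGraph W) (φ : V → W) : Prop :=
  ∃ O' : OrientedGraph V, O.PushRel O' ∧ O'.IsHom H φ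

/-- The pushable chromatic number of an oriented graph: the minimum order of an oriented graph to
which it admits a pushable homomorphism. (For a finite graph the set below contains the order of
the graph itself.) -/
noncomputable def chiP {V : Type} (O : OrientedGraph V) : ℕ :=
  sInf {n : ℕ | ∃ (H : OrientedGraph (Fin n)) (φ : V → Fin n), O.IsPushHom H φ}

end OrientedGraph

/-- The pushable chromatic number of a (finite) undirected graph: the maximum of the pushable
chromatic numbers of its orientations (a nonempty finite set of numbers). -/
noncomputable def chiP {V : Type} (G : SimpleGraph V) : ℕ :=
  sSup {k : ℕ | ∃ O : OrientedGraph V, O.IsOrientationOf G ∧ O.chiP = k}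

/-- The Euclidean plane. -/
abbrev Plane : Type := EuclideanSpace ℝ (Fin 2)

/-- `A` is a (simple) polygonal arc from `x` to `y`: the union of `n ≥ 1` nondegenerate segments
`[p 0, p 1], …, [p (n-1), p n]` with `p 0 = x` and `p n = y`, where consecutive segments meet only
in their common endpoint and non-consecutive segments are disjoint. -/
def IsPolygonalArc (x y : Plane) (A : Set Plane) : Prop :=
  ∃ (n : ℕ) (p : ℕ → Plane), 0 < n ∧ p 0 = x ∧ p n = y ∧
    (∀ i < n, p i ≠ p (i + 1)) ∧
    (∀ i, i + 1 < n →
      segment ℝ (p i) (p (i + 1)) ∩ segment ℝ (p (i + 1)) (p (i + 2)) = {p (i + 1)}) ∧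
    (∀ i j, i + 1 < j → j < n →
      Disjoint (segment ℝ (p i) (p (i + 1))) (segment ℝ (p j) (p (j + 1)))) ∧
    A = ⋃ i ∈ Set.Iio n, segment ℝ (p i) (p (i + 1))

/-- A graph is planar if it can be drawn in the plane: distinct vertices are placed at distinct
points, every edge is drawn as a polygonal arc joining its ends and containing no other vertex, and
the arcs of two distinct edges meet only in points of common ends of these edges. -/
def IsPlanar {V : Type} (G : SimpleGraph V) : Prop :=
  ∃ (pos : V → Plane) (arc : Sym2 V → Set Plane),
    Function.Injective pos ∧
    (∀ u v : V, G.Adj u v → IsPolygonalArc (pos u) (pos v) (arc s(u, v))) ∧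
    (∀ e ∈ G.edgeSet, ∀ w : V, pos w ∈ arc e → w ∈ e) ∧
    (∀ e ∈ G.edgeSet, ∀ f ∈ G.edgeSet, e ≠ f → arc e ∩ arc f ⊆ pos '' {v : V | v ∈ e ∧ v ∈ f})

/-- The family of finite planar graphs of girth at least `g` (acyclic graphs have infinite
girth). -/
def PlanarGirthAtLeast (g : ℕ) {V : Type} (G : SimpleGraph V) : Prop :=
  Finite V ∧ IsPlanar G ∧ (g : ℕ∞) ≤ G.egirth

/-- `m` is the pushable chromatic number of a family `F` of graphs: the maximum of the pushable
chromatic numbers of its members. -/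
def IsFamilyChiP (F : ∀ {V : Type}, SimpleGraph V → Prop) (m : ℕ) : Prop :=
  IsGreatest {k : ℕ | ∃ (V : Type) (G : SimpleGraph V), F G ∧ chiP G = k} m

end PushColoring

open Finset

/-! Upper bound. Signed vertices of the Paley tournament on seven vertices serve as colours, the
sign recording whether a vertex is pushed. Two facts about this target carry the argument. A
coloured neighbour leaves 6 of the 14 colours. A path of length two with one end coloured excludes
at most one colour at its other end (`card_not_compat_le_one`). So a minimal uncolourable graph
cannot have a vertex with too many neighbours of degree two (`exists_coloring_of_two_neighbors`).
Discharging then gives average degree at least 3 (`exists_isColoring`), while Euler's bound gives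
less than 3 for every subgraph of a planar graph of girth at least 6.

Euler's bound is obtained from winding numbers instead of faces. Let `Z` be the real cycle space and
give each edge its coordinate functional on `Z`; this is a circulation with values in the dual of
`Z`, whose winding number is a dual vector. It jumps by 2π times the functional of an edge when that
edge is crossed (`side_swap`), and it is constant along an edge. Around a vertex its values are
partial sums of a family with total zero, so each value `f` is bounded by an even number of edges
there (`card_side_eq`, `exists_sides`). The values thus replace the faces. The edges with `f` on
exactly one side form an even set, hence at least 6 edges when it is nonempty. An edge bounds at
most two values. The values separate `Z × ℝ`, so there are at least `dim Z + 1` of them. Together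
with `dim Z ≥ |E| - |V| + 1` this yields `2|E| < 3|V|` (`IsPolygonalDrawing.two_mul_card_lt`).

Lower bound. Subdivide each edge of `K₄` once, as a directed 2-path. An oriented graph on at most 3
vertices maps to the Cayley digraph of `ZMod 6` with connection set {1, 2}, where a push is absorbed
by adding 3. The four branch vertices would then get residues pairwise differing by 2, 3 or 4, but
`ZMod 6` has room for only three such residues. -/

/-- The vertices of `G`, placed at the points `P`, and the straight segments between adjacent
vertices form a plane drawing. -/
structure IsStraightLine {V : Type} (G : SimpleGraph V) (P : V → ℂ) : Prop where
  inj : Function.Injective P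
  vert : ∀ a b c, G.Adj a b → P c ∈ segment ℝ (P a) (P b) → c = a ∨ c = b
  cross : ∀ a b c d, G.Adj a b → G.Adj c d → s(a, b) ≠ s(c, d) →
    ∀ x ∈ segment ℝ (P a) (P b), x ∈ segment ℝ (P c) (P d) → ∃ u, x = P u

/-- A circulation on `G` with values in `M`. -/
structure IsCirculation {V M : Type} [Fintype V] [AddCommGroup M] (G : SimpleGraph V)
    (z : V → V → M) : Prop where
  anti : ∀ a b, z a b = - z b a
  supp : ∀ a b, ¬ G.Adj a b → z a b = 0
  div : ∀ a, ∑ b, z a b = 0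

/-! ### Segments and the slit plane -/

theorem mem_segment_iff_add_smul {a b x : ℂ} :
    x ∈ segment ℝ a b ↔ ∃ t : ℝ, 0 ≤ t ∧ t ≤ 1 ∧ x = a + t * (b - a) := by
  rw [segment_eq_image', Set.mem_image]
  constructor
  · rintro ⟨t, ⟨h0, h1⟩, rfl⟩
    exact ⟨t, h0, h1, by simp⟩
  · rintro ⟨t, h0, h1, rfl⟩
    exact ⟨t, ⟨h0, h1⟩, by simp⟩

theorem eq_neg_mul_of_div_notMem_slitPlane {a b : ℂ} (ha : a ≠ 0)
    (h : b / a ∉ Complex.slitPlane) : ∃ r : ℝ, 0 ≤ r ∧ b = -r * a := by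
  rw [Complex.mem_slitPlane_iff] at h
  push Not at h
  refine ⟨-(b / a).re, by linarith [h.1], ?_⟩
  have : b / a = ((b / a).re : ℂ) := by
    apply Complex.ext <;> simp [h.2]
  push_cast
  rw [neg_neg, ← this, div_mul_cancel₀ _ ha]

theorem inv_mem_slitPlane {z : ℂ} (h : z ∈ Complex.slitPlane) : z⁻¹ ∈ Complex.slitPlane := by
  have h0 := Complex.slitPlane_ne_zero h
  rw [Complex.mem_slitPlane_iff] at h ⊢
  have := Complex.normSq_pos.mpr h0
  rcases h with h | h
  · left; rw [Complex.inv_re]; positivity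
  · right; rw [Complex.inv_im]; exact div_ne_zero (neg_ne_zero.mpr h) this.ne'

theorem arg_inv_of_mem_slitPlane {z : ℂ} (h : z ∈ Complex.slitPlane) :
    (z⁻¹).arg = - z.arg := by
  rw [Complex.arg_inv, if_neg]
  intro h'
  exact (Complex.mem_slitPlane_iff_arg.mp h).1 h'

/-- A nonpositive real quotient would mean that `a` and `b` are seen from `x` in opposite
directions. The slit plane is where `arg` is differentiable, so the angle subtended by a segment
varies smoothly off that segment. -/
theorem div_mem_slitPlane_of_notMem_segment {a b x : ℂ} (h : x ∉ segment ℝ a b) :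
    (b - x) / (a - x) ∈ Complex.slitPlane := by
  by_contra hc
  have ha : a - x ≠ 0 := by
    intro h0
    exact h (by rw [← sub_eq_zero.mp h0]; exact left_mem_segment ℝ a b)
  obtain ⟨r, hr, hb⟩ := eq_neg_mul_of_div_notMem_slitPlane ha hc
  apply h
  rw [mem_segment_iff_add_smul]
  refine ⟨1 / (1 + r), by positivity, ?_, ?_⟩
  · rw [div_le_one (by positivity)]; linarith
  · have h1 : (1 + r : ℂ) ≠ 0 := by
      have : (1 + r : ℝ) ≠ 0 := by positivity
      exact_mod_cast this
    push_cast
    field_simp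
    linear_combination (-1 : ℂ) * hb

/-! ### Winding numbers on the two sides of a segment -/

section Side

set_option linter.unusedSectionVars false

variable {V : Type} [Fintype V] {M : Type} [AddCommGroup M] [Module ℝ M]

/-- The value (up to a global factor) of the winding number of the circulation `z`, just to the
left of the segment from `P v` to `P w`. -/
noncomputable def side (P : V → ℂ) (z : V → V → M) (v w : V) : M :=
  (1 / 2 : ℝ) • ∑ a, ∑ b, ((P b - P v) / (P a - P v)).arg • z a b
    + ∑ b, (-((P b - P v) / (P w - P v))).arg • z v b

theorem map_side {N : Type} [AddCommGroup N] [Module ℝ N] (φ : M →ₗ[ℝ] N) (P : V → ℂ)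
    (z : V → V → M) (v w : V) : φ (side P z v w) = side P (fun a b => φ (z a b)) v w := by
  simp [side, map_sum]

open Classical in
/-- The vector from a point travelling along the segment from `P v` to `P w` to the vertex `a`,
rescaled if `a` is one of the two ends. -/
noncomputable def sight (P : V → ℂ) (v w : V) (a : V) (t : ℝ) : ℂ :=
  if a = v then -(P w - P v) else if a = w then P w - P v else P a - (P v + t * (P w - P v))

theorem sight_swap (P : V → ℂ) {v w : V} (h : v ≠ w) (a : V) (t : ℝ) :
    sight P v w a t = sight P w v a (1 - t) := by
  unfold sight
  by_cases h1 : a = v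
  · subst h1; simp [h]
  · by_cases h2 : a = w
    · subst h2; simp [h1]
    · simp only [h1, h2, if_false]; push_cast; ring

variable {G : SimpleGraph V} {P : V → ℂ}

theorem sight_ne_zero (hP : IsStraightLine G P) {v w : V} (hvw : G.Adj v w) (a : V) {t : ℝ}
    (h0 : 0 ≤ t) (h1 : t ≤ 1) : sight P v w a t ≠ 0 := by
  have hu : P w - P v ≠ 0 := sub_ne_zero.mpr (hP.inj.ne hvw.ne')
  unfold sight
  split_ifs with h2 h3
  · exact neg_ne_zero.mpr hu
  · exact hu
  · intro h
    have : P a ∈ segment ℝ (P v) (P w) :=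
      mem_segment_iff_add_smul.mpr ⟨t, h0, h1, sub_eq_zero.mp h⟩
    rcases hP.vert v w a hvw this with h | h
    · exact h2 h
    · exact h3 h

/-- Otherwise `b` lies ahead on the ray from `P v` through `P w`, so either `b` is on the segment `v
w` or `w` is on the segment `v b`; the drawing forbids both. -/
theorem sight_div_aux (hP : IsStraightLine G P) {v w b : V} (hvw : G.Adj v w) (hvb : G.Adj v b)
    (hb : b ≠ w) {t : ℝ} (h0 : 0 ≤ t) :
    (P b - (P v + t * (P w - P v))) / (-(P w - P v)) ∈ Complex.slitPlane := by
  have hu : P w - P v ≠ 0 := sub_ne_zero.mpr (hP.inj.ne hvw.ne')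
  by_contra hc
  obtain ⟨r, hr, hb'⟩ := eq_neg_mul_of_div_notMem_slitPlane (neg_ne_zero.mpr hu) hc
  have hb2 : P b = P v + ((t + r : ℝ) : ℂ) * (P w - P v) := by
    push_cast; linear_combination hb'
  rcases le_total (t + r) 1 with hs | hs
  · rcases hP.vert v w b hvw
      (mem_segment_iff_add_smul.mpr ⟨t + r, by positivity, hs, hb2⟩) with h | h
    · exact hvb.ne' h
    · exact hb h
  · have hpos : 0 < t + r := by linarith
    have : P w ∈ segment ℝ (P v) (P b) := by
      refine mem_segment_iff_add_smul.mpr ⟨1 / (t + r), by positivity, ?_, ?_⟩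
      · rw [div_le_one hpos]; exact hs
      · rw [hb2]
        have : ((t + r : ℝ) : ℂ) ≠ 0 := by exact_mod_cast hpos.ne'
        rw [add_sub_cancel_left, ← mul_assoc, Complex.ofReal_div, Complex.ofReal_one,
          one_div_mul_cancel this]
        ring
    rcases hP.vert v b w hvb this with h | h
    · exact hvw.ne' h
    · exact hb h.symm

theorem sight_div_left (hP : IsStraightLine G P) {v w b : V} (hvw : G.Adj v w) (hvb : G.Adj v b)
    (hb : b ≠ w) {t : ℝ} (h0 : 0 ≤ t) :
    sight P v w b t / sight P v w v t ∈ Complex.slitPlane := by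
  have := sight_div_aux hP hvw hvb hb h0
  simpa [sight, hb, hvb.ne'] using this

theorem sight_div_mem_slitPlane (hP : IsStraightLine G P) {v w : V} (hvw : G.Adj v w) {a b : V}
    (hab : G.Adj a b) (hne : s(a, b) ≠ s(v, w)) {t : ℝ} (h0 : 0 ≤ t) (h1 : t ≤ 1) :
    sight P v w b t / sight P v w a t ∈ Complex.slitPlane := by
  have key : ∀ a b, G.Adj a b → s(a, b) ≠ s(v, w) → (a = v ∨ a = w) →
      sight P v w b t / sight P v w a t ∈ Complex.slitPlane := by
    rintro a b hab hne (rfl | rfl)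
    · exact sight_div_left hP hvw hab (fun h => hne (by rw [h])) h0
    · rw [sight_swap P hvw.ne, sight_swap P hvw.ne a]
      exact sight_div_left hP hvw.symm hab (fun h => hne (by rw [h, Sym2.eq_swap]))
        (by linarith)
  by_cases ha : a = v ∨ a = w
  · exact key a b hab hne ha
  by_cases hb : b = v ∨ b = w
  · have := key b a hab.symm (by rwa [Sym2.eq_swap]) hb
    have := inv_mem_slitPlane this
    rwa [inv_div] at this
  push Not at ha hb
  simp only [sight, ha, hb, if_false]
  apply div_mem_slitPlane_of_notMem_segment
  intro hx
  obtain ⟨u, hu⟩ := hP.cross a b v w hab hvw hne _ hx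
    (mem_segment_iff_add_smul.mpr ⟨t, h0, h1, rfl⟩)
  have hu1 := hP.vert a b u hab (hu ▸ hx)
  have hu2 := hP.vert v w u hvw (hu ▸ mem_segment_iff_add_smul.mpr ⟨t, h0, h1, rfl⟩)
  rcases hu1 with rfl | rfl <;> rcases hu2 with h | h <;> simp_all

theorem hasDerivAt_sight (v w a : V) (t : ℝ) : HasDerivAt (sight P v w a)
    ((open Classical in if a = v ∨ a = w then 0 else -(P w - P v)) : ℂ) t := by
  unfold sight
  by_cases h1 : a = v
  · simp only [h1, if_true, true_or]; exact hasDerivAt_const _ _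
  · by_cases h2 : a = w
    · simp only [h2, if_true, or_true]
      exact hasDerivAt_const _ _
    · simp only [h1, h2, if_false, or_self]
      have h := ((Complex.ofRealCLM.hasDerivAt (x := t)).mul_const (P w - P v)).const_add (P v)
      have := h.const_sub (P a)
      simpa using this

open Classical in
/-- The contribution of all segments but `v w` to the winding number at a point of the segment
from `P v` to `P w`. -/
noncomputable def partialWinding (P : V → ℂ) (z : V → V → ℝ) (v w : V) (t : ℝ) : ℝ :=
  ∑ a, ∑ b, if G.Adj a b ∧ s(a, b) ≠ s(v, w) then
    z a b * (sight P v w b t / sight P v w a t).arg else 0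

/-- The derivative of each angle is the difference of a vertex function `ρ` at the two ends, and a
circulation sums such differences to zero. -/
theorem hasDerivAt_partialWinding (hP : IsStraightLine G P) {z : V → V → ℝ}
    (hz : IsCirculation G z) {v w : V} (hvw : G.Adj v w) {t : ℝ} (h0 : 0 ≤ t) (h1 : t ≤ 1) :
    HasDerivAt (partialWinding (G := G) P z v w) 0 t := by
  classical
  set ρ : V → ℝ := fun a =>
    ((if a = v ∨ a = w then 0 else -(P w - P v)) / sight P v w a t : ℂ).im with hρ
  have hterm : ∀ a b, HasDerivAt (fun t => if G.Adj a b ∧ s(a, b) ≠ s(v, w) then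
      z a b * (sight P v w b t / sight P v w a t).arg else 0) (z a b * (ρ b - ρ a)) t := by
    intro a b
    by_cases h : G.Adj a b ∧ s(a, b) ≠ s(v, w)
    · simp only [h, true_and, ne_eq, not_false_eq_true, if_true]
      apply HasDerivAt.const_mul
      have hs := sight_div_mem_slitPlane hP hvw h.1 h.2 h0 h1
      have ha := sight_ne_zero hP hvw a h0 h1
      have hb := sight_ne_zero hP hvw b h0 h1
      have hd := ((hasDerivAt_sight (P := P) v w b t).div (hasDerivAt_sight v w a t) ha).clog_real
        hs
      have := (Complex.imCLM.hasFDerivAt.comp_hasDerivAt t hd)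
      have h3 : (Complex.imCLM : ℂ → ℝ) ∘ (fun t => Complex.log ((sight P v w b / sight P v w a) t))
        = fun t => (sight P v w b t / sight P v w a t).arg := by
        funext s; simp [Complex.log_im]
      rw [h3] at this
      refine this.congr_deriv ?_
      simp only [hρ, Complex.imCLM_apply, ← Complex.sub_im, Pi.div_apply]
      congr 1
      field_simp
    · simp only [if_neg h]
      -- The excluded segment `v w` may be put back into the sum, since `ρ` vanishes at both of its
      -- ends: their sight vectors are constant.
      have : z a b * (ρ b - ρ a) = 0 := by
        by_cases hab : G.Adj a b
        · have hs : s(a, b) = s(v, w) := by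
            by_contra hc; exact h ⟨hab, hc⟩
          have h2 : (a = v ∨ a = w) ∧ (b = v ∨ b = w) := by
            rw [Sym2.eq_iff] at hs; tauto
          simp [hρ, h2.1, h2.2]
        · simp [hz.supp a b hab]
      rw [this]; exact hasDerivAt_const _ _
  have hsum := HasDerivAt.fun_sum (u := Finset.univ) fun a _ =>
    HasDerivAt.fun_sum (u := Finset.univ) fun b _ => hterm a b
  have h0 : ∑ a, ∑ b, z a b * (ρ b - ρ a) = 0 := by
    simp only [mul_sub, Finset.sum_sub_distrib]
    have e1 : ∑ a, ∑ b, z a b * ρ a = 0 := by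
      apply Finset.sum_eq_zero; intro a _
      rw [← Finset.sum_mul, hz.div, zero_mul]
    have e2 : ∑ a, ∑ b, z a b * ρ b = 0 := by
      rw [Finset.sum_comm]
      apply Finset.sum_eq_zero; intro b _
      rw [← Finset.sum_mul]
      have : ∑ a, z a b = 0 := by
        rw [← neg_eq_zero, ← Finset.sum_neg_distrib, ← hz.div b]
        exact Finset.sum_congr rfl fun a _ => (hz.anti b a).symm
      rw [this, zero_mul]
    rw [e1, e2, sub_zero]
  rw [h0] at hsum
  exact hsum

/-- Every edge is counted in both directions, hence the factor 2; the omitted segment `v w` itself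
subtends the angle π from its left side. -/
theorem partialWinding_zero (hP : IsStraightLine G P) {z : V → V → ℝ}
    (hz : IsCirculation G z) {v w : V} (hvw : G.Adj v w) :
    partialWinding (G := G) P z v w 0 = 2 * (side P z v w - Real.pi * z v w) := by
  classical
  have hu : P w - P v ≠ 0 := sub_ne_zero.mpr (hP.inj.ne hvw.ne')
  set A : V → ℝ := fun b => (-((P b - P v) / (P w - P v))).arg with hA
  have hA' : ∀ b, A b = ((P b - P v) / (-(P w - P v))).arg := fun b => by rw [div_neg]
  -- The convention `arg (-1) = π` is what places the viewpoint to the left of the segment.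
  have hAw : A w = Real.pi := by simp [hA, div_self hu]
  have hzz : ∀ a, z a a = 0 := fun a => hz.supp a a (G.loopless.irrefl a)
  set B : V → ℝ := fun b => z v b * (A b - if b = w then Real.pi else 0) with hB
  have hBv : B v = 0 := by simp [hB, hzz]
  have hBw : B w = 0 := by simp [hB, hAw]
  have hsv : sight P v w v 0 = -(P w - P v) := by simp [sight]
  have hsa : ∀ a, a ≠ v → sight P v w a 0 = P a - P v := by
    intro a ha
    by_cases h : a = w <;> simp [sight, ha, h, hvw.ne']
  have hterm : ∀ a b, (if G.Adj a b ∧ s(a, b) ≠ s(v, w) then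
      z a b * (sight P v w b 0 / sight P v w a 0).arg else 0) =
      z a b * ((P b - P v) / (P a - P v)).arg + ((if a = v then B b else 0) +
        (if b = v then B a else 0)) := by
    intro a b
    by_cases hab : G.Adj a b
    swap
    · have e1 := hz.supp a b hab
      have e2 := hz.supp b a (fun h => hab h.symm)
      have : a = v → B b = 0 := by rintro rfl; simp [hB, e1]
      have h' : b = v → B a = 0 := by rintro rfl; simp [hB, e2]
      simp only [hab, false_and, if_false, e1, zero_mul, zero_add]
      split_ifs <;> simp_all
    by_cases hs : s(a, b) = s(v, w)
    · simp only [hs, ne_eq, not_true_eq_false, and_false, if_false]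
      rw [Sym2.eq_iff] at hs
      rcases hs with ⟨rfl, rfl⟩ | ⟨rfl, rfl⟩
      · simp [hBw, hab.ne']
      · simp [hBw, hab.ne]
    simp only [hab, hs, true_and, ne_eq, not_false_eq_true, if_true]
    by_cases ha : a = v
    · subst ha
      have hb := hab.ne'
      have hbw : b ≠ w := fun h => hs (by rw [h])
      rw [hsv, hsa b hb, if_pos rfl, if_neg hb]
      simp only [hB, hbw, if_false, hA', sub_zero, add_zero, zero_add, sub_self, div_zero,
        Complex.arg_zero, mul_zero]
    by_cases hb : b = v
    · subst hb
      have haw : a ≠ w := fun h => hs (by rw [h, Sym2.eq_swap])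
      have hm := sight_div_mem_slitPlane hP hvw hab hs le_rfl zero_le_one
      have hm' := arg_inv_of_mem_slitPlane hm
      rw [inv_div] at hm'
      rw [if_neg ha, if_pos rfl]
      rw [hsv, hsa a ha] at hm' ⊢
      simp only [hB, haw, if_false, hA', hm', hz.anti b a]
      simp
    · rw [hsa a ha, hsa b hb]; simp [ha, hb]
  unfold partialWinding
  simp only [hterm, Finset.sum_add_distrib]
  have e1 : ∑ a, ∑ b, (if a = v then B b else 0) = ∑ b, B b := by
    rw [Finset.sum_comm]; simp
  have e2 : ∑ a, ∑ b, (if b = v then B a else 0) = ∑ b, B b := by simp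
  have e3 : ∑ b, B b = ∑ b, A b * z v b - Real.pi * z v w := by
    simp only [hB, mul_sub, Finset.sum_sub_distrib]
    congr 1
    · exact Finset.sum_congr rfl fun b _ => mul_comm _ _
    · simp [mul_comm]
  rw [e1, e2, e3]
  have e4 : ∑ a, ∑ b, z a b * ((P b - P v) / (P a - P v)).arg =
    ∑ a, ∑ b, ((P b - P v) / (P a - P v)).arg • z a b := by
    simp only [smul_eq_mul, mul_comm]
  rw [e4]
  simp only [side, hA, smul_eq_mul]
  ring

/-- The contribution of the other segments is constant along `v w`. The far end is the near end of
the reversed segment, and the segment's own contribution changes from π to -π. -/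
theorem side_swap_real (hP : IsStraightLine G P) {z : V → V → ℝ}
    (hz : IsCirculation G z) {v w : V} (hvw : G.Adj v w) :
    side P z w v = side P z v w - 2 * Real.pi * z v w := by
  have hc := constant_of_derivWithin_zero (f := partialWinding (G := G) P z v w) (a := 0) (b := 1)
    (fun t ht => (hasDerivAt_partialWinding hP hz hvw ht.1
      ht.2).differentiableAt.differentiableWithinAt)
    (fun t ht => (hasDerivAt_partialWinding hP hz hvw ht.1 ht.2.le).hasDerivWithinAt.derivWithin
      (uniqueDiffOn_Icc zero_lt_one t ⟨ht.1, ht.2.le⟩)) 1 ⟨zero_le_one, le_rfl⟩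
  have h1 : partialWinding (G := G) P z v w 1 = partialWinding (G := G) P z w v 0 := by
    unfold partialWinding
    simp only [sight_swap P hvw.ne _ 1, sub_self]
    exact Finset.sum_congr rfl fun a _ => Finset.sum_congr rfl fun b _ => by
      rw [Sym2.eq_swap (a := v)]
  rw [h1, partialWinding_zero hP hz hvw, partialWinding_zero hP hz hvw.symm, hz.anti w v] at hc
  linarith

theorem IsCirculation.map {N : Type} [AddCommGroup N] [Module ℝ N] {z : V → V → M}
    (hz : IsCirculation G z) (φ : M →ₗ[ℝ] N) : IsCirculation G fun a b => φ (z a b) where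
  anti a b := by rw [hz.anti, map_neg]
  supp a b h := by rw [hz.supp a b h, map_zero]
  div a := by rw [← map_sum, hz.div, map_zero]

/-- Crossing a segment changes the winding number by the value of the circulation there. -/
theorem side_swap (hP : IsStraightLine G P) {Z : Type} [AddCommGroup Z] [Module ℝ Z]
    {z : V → V → Module.Dual ℝ Z} (hz : IsCirculation G z) {v w : V} (hvw : G.Adj v w) :
    side P z w v = side P z v w - (2 * Real.pi) • z v w := by
  ext x
  have := side_swap_real hP (hz.map (Module.Dual.eval ℝ Z x)) hvw
  rw [← map_side, ← map_side] at this
  simpa using this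

end Side

/-! ### Side values around a vertex -/

theorem arg_neg_div_of_arg_le {x y : ℂ} (hx : x ≠ 0) (hy : y ≠ 0) :
    (-(x / y)).arg = x.arg - y.arg + if x.arg ≤ y.arg then Real.pi else -Real.pi := by
  set θ : ℝ := x.arg - y.arg + if x.arg ≤ y.arg then Real.pi else -Real.pi with hθ
  have hmem : θ ∈ Set.Ioc (-Real.pi) Real.pi := by
    have h1 := Complex.neg_pi_lt_arg x
    have h2 := Complex.arg_le_pi x
    have h3 := Complex.neg_pi_lt_arg y
    have h4 := Complex.arg_le_pi y
    rw [hθ]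
    split_ifs with h
    · constructor <;> linarith
    · push Not at h; constructor <;> linarith
  have hexp : Complex.exp (θ * Complex.I) =
      -(Complex.exp (x.arg * Complex.I) / Complex.exp (y.arg * Complex.I)) := by
    rw [← Complex.exp_sub, hθ]
    have : ∀ s : ℝ, (s = Real.pi ∨ s = -Real.pi) →
        Complex.exp (((x.arg - y.arg + s : ℝ) : ℂ) * Complex.I) =
        -Complex.exp (x.arg * Complex.I - y.arg * Complex.I) := by
      rintro s (rfl | rfl)
      · push_cast
        rw [add_mul, Complex.exp_add, Complex.exp_pi_mul_I, sub_mul]; ring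
      · push_cast
        rw [add_mul, Complex.exp_add, neg_mul, Complex.exp_neg, Complex.exp_pi_mul_I, sub_mul]
        norm_num
    apply this
    split_ifs <;> simp
  have hr : -(x / y) = ((‖x‖ / ‖y‖ : ℝ) : ℂ) * Complex.exp (θ * Complex.I) := by
    rw [hexp]
    conv_lhs => rw [← Complex.norm_mul_exp_arg_mul_I x, ← Complex.norm_mul_exp_arg_mul_I y]
    push_cast
    field_simp
  rw [hr, Complex.exp_mul_I]
  exact Complex.arg_mul_cos_add_sin_mul_I (div_pos (norm_pos_iff.mpr hx) (norm_pos_iff.mpr hy)) hmem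

section Rotation

set_option linter.unusedSectionVars false

variable {V : Type} [Fintype V] {M : Type} [AddCommGroup M] [Module ℝ M]
variable {G : SimpleGraph V} {P : V → ℂ}

/-- Distinct edges at a vertex of a plane drawing leave it in distinct directions. -/
theorem arg_injOn (hP : IsStraightLine G P) (v : V) :
    Set.InjOn (fun b => (P b - P v).arg) (G.neighborSet v) := by
  intro b hb w hw h
  by_contra hne
  have hb' : G.Adj v b := hb
  have hw' : G.Adj v w := hw
  have hub : P b - P v ≠ 0 := sub_ne_zero.mpr (hP.inj.ne hb'.ne')
  have hu : P w - P v ≠ 0 := sub_ne_zero.mpr (hP.inj.ne hw'.ne')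
  have hs := sight_div_aux hP hw' hb' hne le_rfl
  have := (Complex.arg_eq_arg_iff hu hub).mp h.symm
  rw [Complex.ofReal_zero, zero_mul, add_zero, ← this, div_neg, mul_div_assoc, div_self hu,
    mul_one, ← Complex.ofReal_div, ← Complex.ofReal_neg, Complex.ofReal_mem_slitPlane] at hs
  have : 0 ≤ ‖P b - P v‖ / ‖P w - P v‖ := by positivity
  linarith

open Classical in
/-- The part of `side P z v w` which does not depend on `w`. -/
noncomputable def sideBase (P : V → ℂ) (z : V → V → M) (v : V) : M :=
  (1 / 2 : ℝ) • ∑ a, ∑ b, ((P b - P v) / (P a - P v)).arg • z a b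
    + ∑ b, (P b - P v).arg • z v b

-- Sorting the directions at `v` by argument turns the angle corrections into partial sums of `z v`;
-- all terms independent of `b` cancel because these values have total zero.
open Classical in
theorem side_eq_sideBase_add (hP : IsStraightLine G P) {z : V → V → M}
    (hz : IsCirculation G z) {v w : V} (hvw : G.Adj v w) :
    side P z v w = sideBase P z v + (2 * Real.pi) •
      ∑ b ∈ G.neighborFinset v with (P b - P v).arg ≤ (P w - P v).arg, z v b := by
  have hu : P w - P v ≠ 0 := sub_ne_zero.mpr (hP.inj.ne hvw.ne')
  unfold side sideBase
  rw [add_assoc]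
  congr 1
  have hterm : ∀ b, (-((P b - P v) / (P w - P v))).arg • z v b =
      (P b - P v).arg • z v b - ((P w - P v).arg + Real.pi) • z v b +
      (2 * Real.pi) • (if G.Adj v b ∧ (P b - P v).arg ≤ (P w - P v).arg then z v b else 0) := by
    intro b
    by_cases hb : G.Adj v b
    · rw [arg_neg_div_of_arg_le (sub_ne_zero.mpr (hP.inj.ne hb.ne')) hu]
      simp only [hb, true_and]
      split_ifs <;> module
    · simp [hz.supp v b hb]
  simp only [hterm, Finset.sum_add_distrib, Finset.sum_sub_distrib, ← Finset.smul_sum, hz.div,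
    smul_zero, sub_zero]
  congr 2
  rw [← Finset.sum_filter]
  apply Finset.sum_congr _ fun _ _ => rfl
  ext b; simp

open Classical in
theorem side_swap_eq_sideBase_add (hP : IsStraightLine G P) {Z : Type} [AddCommGroup Z]
    [Module ℝ Z] {z : V → V → Module.Dual ℝ Z}
    (hz : IsCirculation G z) {v w : V} (hvw : G.Adj v w) :
    side P z w v = sideBase P z v + (2 * Real.pi) •
      ∑ b ∈ G.neighborFinset v with (P b - P v).arg < (P w - P v).arg, z v b := by
  rw [side_swap hP hz hvw, side_eq_sideBase_add hP hz hvw]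
  have : {b ∈ G.neighborFinset v | (P b - P v).arg ≤ (P w - P v).arg} =
      insert w {b ∈ G.neighborFinset v | (P b - P v).arg < (P w - P v).arg} := by
    ext b
    simp only [mem_filter, SimpleGraph.mem_neighborFinset, mem_insert]
    constructor
    · rintro ⟨h1, h2⟩
      rcases h2.lt_or_eq with h | h
      · exact Or.inr ⟨h1, h⟩
      · exact Or.inl (arg_injOn hP v h1 hvw h)
    · rintro (rfl | ⟨h1, h2⟩)
      · exact ⟨hvw, le_rfl⟩
      · exact ⟨h1, h2.le⟩
  rw [this, Finset.sum_insert (by simp)]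
  module

/-- Inclusive and exclusive partial sums of a family indexed by a finite chain take the same
values, up to the total sum and zero. -/
theorem card_partialSum_eq {ι N : Type} [AddCommMonoid N] [DecidableEq N]
    (α : ι → ℝ) (c : ι → N) (y : N) (A : Finset ι) (hα : Set.InjOn α A) :
    #{r ∈ A | ∑ b ∈ A with α b ≤ α r, c b = y} + (if (0 : N) = y then 1 else 0) =
    #{r ∈ A | ∑ b ∈ A with α b < α r, c b = y} + (if ∑ b ∈ A, c b = y then 1 else 0) := by
  classical
  induction A using Finset.induction_on_max_value α with
  | empty => rfl
  | insert m A hm hmax ih =>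
    have hlt : ∀ b ∈ A, α b < α m := fun b hb =>
      (hmax b hb).lt_of_ne fun h => hm (hα (by simp [hb]) (by simp) h ▸ hb)
    have e1 : ∀ r ∈ A, ∑ b ∈ insert m A with α b ≤ α r, c b = ∑ b ∈ A with α b ≤ α r, c b := by
      intro r hr
      rw [Finset.filter_insert, if_neg (not_le.mpr (hlt r hr))]
    have e2 : ∀ r ∈ A, ∑ b ∈ insert m A with α b < α r, c b = ∑ b ∈ A with α b < α r, c b := by
      intro r hr
      rw [Finset.filter_insert, if_neg (not_lt.mpr (hlt r hr).le)]
    have e3 : ∑ b ∈ insert m A with α b ≤ α m, c b = ∑ b ∈ insert m A, c b := by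
      rw [Finset.filter_true_of_mem]
      intro b hb
      rcases Finset.mem_insert.mp hb with rfl | hb
      · exact le_rfl
      · exact (hlt b hb).le
    have e4 : ∑ b ∈ insert m A with α b < α m, c b = ∑ b ∈ A, c b := by
      rw [Finset.filter_insert, if_neg (lt_irrefl _), Finset.filter_true_of_mem hlt]
    have hcard : ∀ p : ι → Prop, ∀ _ : DecidablePred p,
        #{r ∈ insert m A | p r} = (if p m then 1 else 0) + #{r ∈ A | p r} := by
      intro p _
      rw [Finset.filter_insert]
      split_ifs
      · rw [Finset.card_insert_of_notMem (by simp [hm]), add_comm]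
      · rw [zero_add]
    have f1 : {r ∈ A | ∑ b ∈ insert m A with α b ≤ α r, c b = y} =
        {r ∈ A | ∑ b ∈ A with α b ≤ α r, c b = y} :=
      Finset.filter_congr fun r hr => by rw [e1 r hr]
    have f2 : {r ∈ A | ∑ b ∈ insert m A with α b < α r, c b = y} =
        {r ∈ A | ∑ b ∈ A with α b < α r, c b = y} :=
      Finset.filter_congr fun r hr => by rw [e2 r hr]
    have ih := ih (hα.mono (by simp))
    rw [hcard, hcard, f1, f2, e3, e4]
    omega

open Classical in
/-- Around a vertex, each value occurs as often to the left of outgoing segments as to the left of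
incoming ones. -/
theorem card_side_eq (hP : IsStraightLine G P) {Z : Type} [AddCommGroup Z]
    [Module ℝ Z] {z : V → V → Module.Dual ℝ Z} (hz : IsCirculation G z) (v : V)
    (f : Module.Dual ℝ Z) :
    #{w ∈ G.neighborFinset v | side P z v w = f} = #{w ∈ G.neighborFinset v | side P z w v = f} := by
  set y := (2 * Real.pi)⁻¹ • (f - sideBase P z v) with hy
  have hpi : (2 * Real.pi) ≠ 0 := by positivity
  have hiff : ∀ s, sideBase P z v + (2 * Real.pi) • s = f ↔ s = y := by
    intro s
    rw [hy, eq_inv_smul_iff₀ hpi, eq_sub_iff_add_eq, add_comm]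
  have h0 : ∑ b ∈ G.neighborFinset v, z v b = 0 := by
    rw [← hz.div v]
    apply Finset.sum_subset (Finset.subset_univ _)
    intro b _ hb
    exact hz.supp v b (by simpa using hb)
  have := card_partialSum_eq (fun b => (P b - P v).arg) (z v) y (G.neighborFinset v)
    (by simpa using arg_injOn hP v)
  rw [h0] at this
  convert Nat.add_right_cancel this using 2
  · apply Finset.filter_congr
    intro w hw
    rw [side_eq_sideBase_add hP hz (by simpa using hw), hiff]
  · apply Finset.filter_congr
    intro w hw
    rw [side_swap_eq_sideBase_add hP hz (by simpa using hw), hiff]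

/-- At a vertex of degree two, the left side of the incoming segment continues to the left side of
the outgoing one. -/
theorem side_eq_side_of_degree_two (hP : IsStraightLine G P) {Z : Type} [AddCommGroup Z]
    [Module ℝ Z] {z : V → V → Module.Dual ℝ Z} (hz : IsCirculation G z) {v a b : V} (hab : a ≠ b)
    (hv : ∀ w, G.Adj v w ↔ w = a ∨ w = b) : side P z a v = side P z v b := by
  classical
  have ha : G.Adj v a := (hv a).mpr (Or.inl rfl)
  have hb : G.Adj v b := (hv b).mpr (Or.inr rfl)
  have hne : (P a - P v).arg ≠ (P b - P v).arg := fun h => hab (arg_injOn hP v ha hb h)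
  have hN : G.neighborFinset v = {a, b} := by ext w; simp [hv]
  have h0 : z v a + z v b = 0 := by
    rw [← hz.div v, ← Finset.sum_pair hab]
    apply Finset.sum_subset (Finset.subset_univ _)
    intro w _ hw
    exact hz.supp v w (by rw [hv]; simpa using hw)
  rw [side_swap_eq_sideBase_add hP hz ha, side_eq_sideBase_add hP hz hb, hN]
  rcases hne.lt_or_gt with h | h
  · simp [Finset.filter_insert, Finset.filter_singleton, h.le, h.not_gt, Finset.sum_pair hab, h0]
  · simp [Finset.filter_insert, Finset.filter_singleton, h, h.not_ge]

end Rotation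

/-! ### Polygonal drawings and their straight-line subdivisions -/

/-- A plane drawing of a graph with edges `E` (with ends `tl e` and `hd e`) whose vertices are
placed at the points `pos` and where the edge `e` is drawn as the simple polygonal arc through the
points `p e 0, …, p e (n e)`. -/
structure IsPolygonalDrawing {V E : Type} (tl hd : E → V) (pos : V → ℂ) (n : E → ℕ)
    (p : E → ℕ → ℂ) : Prop where
  inj : Function.Injective pos
  simple : ∀ e f, s(tl e, hd e) = s(tl f, hd f) → e = f
  pos_n : ∀ e, 0 < n e
  start : ∀ e, p e 0 = pos (tl e)
  finish : ∀ e, p e (n e) = pos (hd e)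
  nondeg : ∀ e i, i < n e → p e i ≠ p e (i + 1)
  consec : ∀ e i, i + 1 < n e →
    segment ℝ (p e i) (p e (i + 1)) ∩ segment ℝ (p e (i + 1)) (p e (i + 2)) = {p e (i + 1)}
  disj : ∀ e i j, i + 1 < j → j < n e →
    Disjoint (segment ℝ (p e i) (p e (i + 1))) (segment ℝ (p e j) (p e (j + 1)))
  vert : ∀ e i w, i < n e → pos w ∈ segment ℝ (p e i) (p e (i + 1)) → w = tl e ∨ w = hd e
  cross : ∀ e f i j, e ≠ f → i < n e → j < n f → ∀ x ∈ segment ℝ (p e i) (p e (i + 1)),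
    x ∈ segment ℝ (p f j) (p f (j + 1)) → ∃ w, x = pos w

namespace IsPolygonalDrawing

section

set_option linter.unusedSectionVars false

variable {V E : Type} {tl hd : E → V} {pos : V → ℂ} {n : E → ℕ} {p : E → ℕ → ℂ}

theorem exists_mem_segment (h : IsPolygonalDrawing tl hd pos n p) {e : E} {i : ℕ} (hi : i ≤ n e) :
    ∃ j < n e, p e i ∈ segment ℝ (p e j) (p e (j + 1)) := by
  rcases hi.lt_or_eq with hi | hi
  · exact ⟨i, hi, left_mem_segment ℝ _ _⟩
  · obtain ⟨m, hm⟩ := Nat.exists_eq_succ_of_ne_zero (h.pos_n e).ne'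
    refine ⟨m, by omega, ?_⟩
    rw [hi, hm]; exact right_mem_segment ℝ _ _

theorem injOn (h : IsPolygonalDrawing tl hd pos n p) {e : E} {i j : ℕ} (hi : i ≤ n e)
    (hj : j ≤ n e) (hij : p e i = p e j) : i = j := by
  wlog hlt : i < j generalizing i j
  · rcases lt_trichotomy i j with h' | h' | h'
    · exact this hi hj hij h'
    · exact h'
    · exact (this hj hi hij.symm h').symm
  exfalso
  obtain ⟨m, rfl⟩ : ∃ m, j = m + 1 := ⟨j - 1, by omega⟩
  have h1 : p e i ∈ segment ℝ (p e i) (p e (i + 1)) := left_mem_segment ℝ _ _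
  have h2 : p e i ∈ segment ℝ (p e m) (p e (m + 1)) := hij ▸ right_mem_segment ℝ _ _
  rcases (show i = m ∨ i + 1 = m ∨ i + 1 < m by omega) with rfl | rfl | h3
  · exact h.nondeg e i (by omega) hij
  · have : p e i ∈ ({p e (i + 1)} : Set ℂ) := by
      rw [← h.consec e i (by omega)]; exact ⟨h1, h2⟩
    exact h.nondeg e i (by omega) this
  · exact Set.disjoint_left.mp (h.disj e i m h3 (by omega)) h1 h2

theorem eq_of_mem_segments (h : IsPolygonalDrawing tl hd pos n p) {e : E} {i j : ℕ} (hij : i < j)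
    (hj : j < n e) {x : ℂ} (h1 : x ∈ segment ℝ (p e i) (p e (i + 1)))
    (h2 : x ∈ segment ℝ (p e j) (p e (j + 1))) : x = p e j ∧ j = i + 1 := by
  rcases (show i + 1 = j ∨ i + 1 < j by omega) with rfl | h3
  · have : x ∈ ({p e (i + 1)} : Set ℂ) := by
      rw [← h.consec e i (by omega)]; exact ⟨h1, h2⟩
    exact ⟨this, rfl⟩
  · exact (Set.disjoint_left.mp (h.disj e i j h3 hj) h1 h2).elim

theorem eq_or_eq_of_mem_segment (h : IsPolygonalDrawing tl hd pos n p) {e : E} {i j : ℕ}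
    (hi : i < n e) (hj : j ≤ n e) (hm : p e j ∈ segment ℝ (p e i) (p e (i + 1))) :
    j = i ∨ j = i + 1 := by
  obtain ⟨m, hm1, hm2⟩ := h.exists_mem_segment hj
  rcases lt_trichotomy i m with hlt | rfl | hlt
  · obtain ⟨h1, h2⟩ := h.eq_of_mem_segments hlt hm1 hm hm2
    have := h.injOn hj hm1.le h1
    omega
  · rcases hj.lt_or_eq with hj | hj
    · rcases lt_trichotomy i j with hlt | rfl | hlt
      · obtain ⟨h1, h2⟩ := h.eq_of_mem_segments hlt hj hm (left_mem_segment ℝ _ _)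
        omega
      · exact Or.inl rfl
      · obtain ⟨h1, h2⟩ := h.eq_of_mem_segments hlt hi (left_mem_segment ℝ _ _) hm
        exact Or.inl (h.injOn hj.le hi.le h1)
    · have hmem : p e j ∈ segment ℝ (p e (n e - 1)) (p e (n e - 1 + 1)) := by
        rw [Nat.sub_add_cancel (h.pos_n e), hj]; exact right_mem_segment ℝ _ _
      rcases (show i < n e - 1 ∨ i = n e - 1 by omega) with hlt | heq
      · obtain ⟨h1, h2⟩ := h.eq_of_mem_segments hlt (by omega) hm hmem
        have := h.injOn hj.le (by omega) h1
        omega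
      · omega
  · obtain ⟨h1, h2⟩ := h.eq_of_mem_segments hlt hi hm2 hm
    exact Or.inl (h.injOn hj hi.le h1)

theorem eq_pos_iff (h : IsPolygonalDrawing tl hd pos n p) {e : E} {i : ℕ} (hi : i ≤ n e) {w : V} :
    p e i = pos w ↔ (i = 0 ∧ w = tl e) ∨ (i = n e ∧ w = hd e) := by
  constructor
  · intro hw
    obtain ⟨j, hj, hm⟩ := h.exists_mem_segment hi
    rcases h.vert e j w hj (hw ▸ hm) with rfl | rfl
    · rw [← h.start] at hw
      exact Or.inl ⟨h.injOn hi (Nat.zero_le _) hw, rfl⟩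
    · rw [← h.finish] at hw
      exact Or.inr ⟨h.injOn hi le_rfl hw, rfl⟩
  · rintro (⟨rfl, rfl⟩ | ⟨rfl, rfl⟩)
    · exact h.start e
    · exact h.finish e

theorem tl_ne_hd (h : IsPolygonalDrawing tl hd pos n p) (e : E) : tl e ≠ hd e := by
  intro he
  have : p e 0 = p e (n e) := by rw [h.start, h.finish, he]
  exact (h.pos_n e).ne (h.injOn (Nat.zero_le _) le_rfl this)

theorem exists_pos_of_ne (h : IsPolygonalDrawing tl hd pos n p) {e f : E} (hef : e ≠ f) {i j : ℕ}
    (hi : i ≤ n e) (hj : j ≤ n f) (hij : p e i = p f j) : ∃ w, p e i = pos w := by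
  obtain ⟨a, ha, hma⟩ := h.exists_mem_segment hi
  obtain ⟨b, hb, hmb⟩ := h.exists_mem_segment hj
  exact h.cross e f a b hef ha hb _ hma (hij ▸ hmb)

/-- A segment of the drawing determines its edge and its place on it. -/
theorem segment_unique (h : IsPolygonalDrawing tl hd pos n p) {e f : E} {i j : ℕ} (hi : i < n e)
    (hj : j < n f) (heq : s(p e i, p e (i + 1)) = s(p f j, p f (j + 1))) : e = f ∧ i = j := by
  by_cases hef : e = f
  · subst hef
    refine ⟨rfl, ?_⟩
    rw [Sym2.eq_iff] at heq
    rcases heq with ⟨h1, -⟩ | ⟨h1, h2⟩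
    · exact h.injOn hi.le hj.le h1
    · have := h.injOn hi.le hj h1
      have := h.injOn hi hj.le h2
      omega
  · exfalso
    have key : ∀ x, x ∈ s(p e i, p e (i + 1)) → ∃ w, x = pos w ∧ w ∈ s(tl e, hd e) ∧
        w ∈ s(tl f, hd f) := by
      intro x hx
      have hx' := hx
      rw [heq] at hx'
      rw [Sym2.mem_iff] at hx hx'
      have m1 : x ∈ segment ℝ (p e i) (p e (i + 1)) := by
        rcases hx with rfl | rfl
        · exact left_mem_segment ℝ _ _
        · exact right_mem_segment ℝ _ _
      have m2 : x ∈ segment ℝ (p f j) (p f (j + 1)) := by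
        rcases hx' with rfl | rfl
        · exact left_mem_segment ℝ _ _
        · exact right_mem_segment ℝ _ _
      obtain ⟨w, rfl⟩ := h.cross e f i j hef hi hj x m1 m2
      exact ⟨w, rfl, Sym2.mem_iff.mpr (h.vert e i w hi m1), Sym2.mem_iff.mpr (h.vert f j w hj m2)⟩
    obtain ⟨w₁, e1, a1, b1⟩ := key _ (Sym2.mem_mk_left _ _)
    obtain ⟨w₂, e2, a2, b2⟩ := key _ (Sym2.mem_mk_right _ _)
    have hne : w₁ ≠ w₂ := fun hw => h.nondeg e i hi (by rw [e1, e2, hw])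
    apply hef
    apply h.simple
    rw [(Sym2.mem_and_mem_iff hne).mp ⟨a1, a2⟩, (Sym2.mem_and_mem_iff hne).mp ⟨b1, b2⟩]

end

section Subdivision

set_option linter.unusedSectionVars false

variable {V E : Type} (pos : V → ℂ) (n : E → ℕ) (p : E → ℕ → ℂ)

/-- The vertices of a polygonal drawing together with the corners of its arcs. -/
def Corner : Type := {x : ℂ // (∃ v, x = pos v) ∨ ∃ e i, i ≤ n e ∧ x = p e i}

theorem finite_corner [Finite V] [Finite E] : Finite (Corner pos n p) := by
  have : {x : ℂ | (∃ v, x = pos v) ∨ ∃ e i, i ≤ n e ∧ x = p e i} ⊆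
      Set.range pos ∪ ⋃ e, p e '' Set.Iic (n e) := by
    rintro x (⟨v, rfl⟩ | ⟨e, i, hi, rfl⟩)
    · exact Or.inl ⟨v, rfl⟩
    · exact Or.inr (Set.mem_iUnion.mpr ⟨e, i, hi, rfl⟩)
  exact ((Set.finite_range pos).union (Set.finite_iUnion fun e =>
    (Set.finite_Iic (n e)).image _)).subset this

/-- The `i`-th corner of the edge `e`. -/
def corner (e : E) (i : ℕ) : Corner pos n p :=
  ⟨p e (min i (n e)), Or.inr ⟨e, _, min_le_right _ _, rfl⟩⟩

/-- The corner at which the vertex `v` is placed. -/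
def vertexCorner (v : V) : Corner pos n p := ⟨pos v, Or.inl ⟨v, rfl⟩⟩

theorem corner_val {e : E} {i : ℕ} (hi : i ≤ n e) : (corner pos n p e i).1 = p e i := by
  simp [corner, hi]

variable {pos n p} {tl hd : E → V}

/-- The straight-line graph obtained by making every corner a vertex. -/
def subdivision (h : IsPolygonalDrawing tl hd pos n p) : SimpleGraph (Corner pos n p) where
  Adj x y := ∃ e i, i < n e ∧ s(x.1, y.1) = s(p e i, p e (i + 1))
  symm := ⟨fun x y ⟨e, i, hi, hs⟩ => ⟨e, i, hi, by rw [← hs, Sym2.eq_swap]⟩⟩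
  loopless := ⟨fun x ⟨e, i, hi, hs⟩ => by
    rw [Sym2.eq_iff] at hs
    apply h.nondeg e i hi
    rcases hs with ⟨h1, h2⟩ | ⟨h1, h2⟩ <;> rw [← h1, ← h2]⟩

theorem segment_eq_of_mk_eq {a b c d : ℂ} (h : s(a, b) = s(c, d)) :
    segment ℝ a b = segment ℝ c d := by
  rw [Sym2.eq_iff] at h
  rcases h with ⟨rfl, rfl⟩ | ⟨rfl, rfl⟩
  · rfl
  · exact segment_symm ℝ _ _

theorem isStraightLine_subdivision (h : IsPolygonalDrawing tl hd pos n p) :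
    IsStraightLine h.subdivision (fun x => x.1) where
  inj := Subtype.val_injective
  vert := by
    rintro a b c ⟨e, i, hi, hs⟩ hc
    have key : c.1 ∈ s(p e i, p e (i + 1)) := by
      replace hc : c.1 ∈ segment ℝ (p e i) (p e (i + 1)) := segment_eq_of_mk_eq hs ▸ hc
      have hv : ∀ w, c.1 = pos w → ∃ j ≤ n e, c.1 = p e j := by
        intro w hw
        rcases h.vert e i w hi (hw ▸ hc) with rfl | rfl
        · exact ⟨0, Nat.zero_le _, by rw [h.start, hw]⟩
        · exact ⟨n e, le_rfl, by rw [h.finish, hw]⟩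
      have : ∃ j ≤ n e, c.1 = p e j := by
        rcases c.2 with ⟨w, hw⟩ | ⟨f, j, hj, hf⟩
        · exact hv w hw
        · by_cases hef : e = f
          · subst hef; exact ⟨j, hj, hf⟩
          · obtain ⟨k, hk, hm⟩ := h.exists_mem_segment hj
            obtain ⟨w, hw⟩ := h.cross e f i k hef hi hk c.1 hc (hf ▸ hm)
            exact hv w hw
      obtain ⟨j, hj, hcj⟩ := this
      rw [hcj] at hc ⊢
      rcases h.eq_or_eq_of_mem_segment hi hj hc with rfl | rfl
      · exact Sym2.mem_mk_left _ _
      · exact Sym2.mem_mk_right _ _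
    rw [← hs, Sym2.mem_iff] at key
    exact key.imp Subtype.ext Subtype.ext
  cross := by
    rintro a b c d ⟨e, i, hi, hs⟩ ⟨f, j, hj, hs'⟩ hne x hx hx'
    rw [segment_eq_of_mk_eq hs] at hx
    rw [segment_eq_of_mk_eq hs'] at hx'
    by_cases hef : e = f
    · subst hef
      rcases lt_trichotomy i j with hlt | rfl | hlt
      · exact ⟨⟨x, Or.inr ⟨e, j, hj.le, (h.eq_of_mem_segments hlt hj hx hx').1⟩⟩, rfl⟩
      · exfalso
        apply hne
        have := hs.trans hs'.symm
        rw [Sym2.eq_iff] at this ⊢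
        exact this.imp (And.imp Subtype.ext Subtype.ext) (And.imp Subtype.ext Subtype.ext)
      · exact ⟨⟨x, Or.inr ⟨e, i, hi.le, (h.eq_of_mem_segments hlt hi hx' hx).1⟩⟩, rfl⟩
    · obtain ⟨w, hw⟩ := h.cross e f i j hef hi hj x hx hx'
      exact ⟨⟨x, Or.inl ⟨w, hw⟩⟩, rfl⟩

theorem adj_corner (h : IsPolygonalDrawing tl hd pos n p) {e : E} {i : ℕ} (hi : i < n e) :
    h.subdivision.Adj (corner pos n p e i) (corner pos n p e (i + 1)) :=
  ⟨e, i, hi, by rw [corner_val _ _ _ hi.le, corner_val _ _ _ hi]⟩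

theorem corner_injOn (h : IsPolygonalDrawing tl hd pos n p) {e : E} {i j : ℕ} (hi : i ≤ n e)
    (hj : j ≤ n e) (hij : corner pos n p e i = corner pos n p e j) : i = j := by
  apply h.injOn hi hj
  rw [← corner_val pos n p hi, ← corner_val pos n p hj, hij]

/-- The inner corners of an edge have degree two. -/
theorem adj_inner_corner (h : IsPolygonalDrawing tl hd pos n p) {e : E} {i : ℕ} (hi : i + 1 < n e)
    (y : Corner pos n p) : h.subdivision.Adj (corner pos n p e (i + 1)) y ↔
      y = corner pos n p e i ∨ y = corner pos n p e (i + 2) := by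
  constructor
  · rintro ⟨f, j, hj, hs⟩
    rw [corner_val _ _ _ hi.le] at hs
    have hm : p e (i + 1) ∈ s(p f j, p f (j + 1)) := hs ▸ Sym2.mem_mk_left _ _
    have hef : e = f := by
      by_contra hef
      have : ∃ w, p e (i + 1) = pos w := by
        rcases Sym2.mem_iff.mp hm with h1 | h1
        · exact h.exists_pos_of_ne hef hi.le hj.le h1
        · exact h.exists_pos_of_ne hef hi.le hj h1
      obtain ⟨w, hw⟩ := this
      rw [h.eq_pos_iff hi.le] at hw
      omega
    subst hef
    rw [Sym2.eq_iff] at hs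
    rcases hs with ⟨h1, h2⟩ | ⟨h1, h2⟩
    · have := h.injOn hi.le hj.le h1
      subst this
      right; apply Subtype.ext; rw [h2, corner_val _ _ _ (by omega)]
    · have := h.injOn hi.le hj h1
      obtain rfl : i = j := by omega
      left; apply Subtype.ext; rw [h2, corner_val _ _ _ (by omega)]
  · rintro (rfl | rfl)
    · exact (h.adj_corner (by omega)).symm
    · exact h.adj_corner hi

open Classical in
/-- The circulation on the subdivision induced by a circulation on the drawn graph. -/
noncomputable def lift {M : Type} [AddCommGroup M] [Fintype E] (_ : IsPolygonalDrawing tl hd pos n p)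
    (z : E → M) (x y : Corner pos n p) : M :=
  ∑ e, ∑ i ∈ Finset.range (n e), ((if x.1 = p e i ∧ y.1 = p e (i + 1) then z e else 0) -
    if y.1 = p e i ∧ x.1 = p e (i + 1) then z e else 0)

-- At each corner the contribution of an edge telescopes along its arc, leaving only its two ends,
-- where the conservation law of `z` applies.
open Classical in
theorem isCirculation_lift {M : Type} [AddCommGroup M] [Fintype E] [Fintype (Corner pos n p)]
    (h : IsPolygonalDrawing tl hd pos n p) {z : E → M}
    (hz : ∀ v, ∑ e, ((if tl e = v then z e else 0) - if hd e = v then z e else 0) = 0) :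
    IsCirculation h.subdivision (h.lift z) where
  anti x y := by
    unfold lift
    rw [← Finset.sum_neg_distrib]
    refine Finset.sum_congr rfl fun e _ => ?_
    rw [← Finset.sum_neg_distrib]
    refine Finset.sum_congr rfl fun i _ => ?_
    rw [neg_sub]
  supp x y hxy := by
    unfold lift
    refine Finset.sum_eq_zero fun e _ => Finset.sum_eq_zero fun i hi => ?_
    rw [Finset.mem_range] at hi
    rw [if_neg, if_neg, sub_zero]
    · rintro ⟨h1, h2⟩
      exact hxy ⟨e, i, hi, by rw [h1, h2, Sym2.eq_swap]⟩
    · rintro ⟨h1, h2⟩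
      exact hxy ⟨e, i, hi, by rw [h1, h2]⟩
  div x := by
    unfold lift
    have hone : ∀ (e : E) (i : ℕ), i ≤ n e → ∀ a : Prop,
        ∑ y : Corner pos n p, (if a ∧ y.1 = p e i then z e else 0) = if a then z e else 0 := by
      intro e i hi a
      rw [Finset.sum_eq_single (corner pos n p e i)]
      · rw [corner_val _ _ _ hi]; simp
      · intro y _ hy
        rw [if_neg]
        rintro ⟨-, h2⟩
        exact hy (Subtype.ext (by rw [h2, corner_val _ _ _ hi]))
      · simp
    have hrow : ∀ e, ∑ y : Corner pos n p, ∑ i ∈ Finset.range (n e),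
        ((if x.1 = p e i ∧ y.1 = p e (i + 1) then z e else 0) -
          if y.1 = p e i ∧ x.1 = p e (i + 1) then z e else 0) =
        (if x.1 = p e 0 then z e else 0) - if x.1 = p e (n e) then z e else 0 := by
      intro e
      rw [Finset.sum_comm, ← Finset.sum_range_sub' (fun i => if x.1 = p e i then z e else 0)]
      refine Finset.sum_congr rfl fun i hi => ?_
      rw [Finset.mem_range] at hi
      rw [Finset.sum_sub_distrib, hone e (i + 1) hi]
      simp only [and_comm (b := x.1 = _)]
      rw [hone e i hi.le]
    rw [Finset.sum_comm]
    simp only [hrow, h.start, h.finish]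
    by_cases hx : ∃ v, x.1 = pos v
    · obtain ⟨v, hv⟩ := hx
      refine Eq.trans ?_ (hz v)
      refine Finset.sum_congr rfl fun e _ => ?_
      simp only [hv, h.inj.eq_iff, eq_comm]
    · push Not at hx
      simp [hx]

theorem lift_corner {M : Type} [AddCommGroup M] [Fintype E]
    (h : IsPolygonalDrawing tl hd pos n p) (z : E → M) {e : E} {i : ℕ} (hi : i < n e) :
    h.lift z (corner pos n p e i) (corner pos n p e (i + 1)) = z e := by
  unfold lift
  rw [corner_val _ _ _ hi.le, corner_val _ _ _ hi]
  rw [Finset.sum_eq_single e, Finset.sum_eq_single i]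
  · rw [if_pos ⟨rfl, rfl⟩, if_neg, sub_zero]
    rintro ⟨h1, -⟩
    exact h.nondeg e i hi h1.symm
  · intro j hj hji
    rw [Finset.mem_range] at hj
    rw [if_neg, if_neg, sub_zero]
    · rintro ⟨h1, h2⟩
      exact hji (h.segment_unique hi hj (by rw [h1, h2, Sym2.eq_swap])).2.symm
    · rintro ⟨h1, h2⟩
      exact hji (h.segment_unique hi hj (by rw [h1, h2])).2.symm
  · intro hh; exact (hh (Finset.mem_range.mpr hi)).elim
  · intro f _ hf
    refine Finset.sum_eq_zero fun j hj => ?_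
    rw [Finset.mem_range] at hj
    rw [if_neg, if_neg, sub_zero]
    · rintro ⟨h1, h2⟩
      exact hf (h.segment_unique hi hj (by rw [h1, h2, Sym2.eq_swap])).1.symm
    · rintro ⟨h1, h2⟩
      exact hf (h.segment_unique hi hj (by rw [h1, h2])).1.symm
  · simp

/-- The left side of an edge is the same along the whole edge. -/
theorem side_corner (h : IsPolygonalDrawing tl hd pos n p) [Fintype (Corner pos n p)]
    {Z : Type} [AddCommGroup Z] [Module ℝ Z]
    {z : Corner pos n p → Corner pos n p → Module.Dual ℝ Z} (hz : IsCirculation h.subdivision z)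
    {e : E} {i : ℕ} (hi : i < n e) :
    side (fun x => x.1) z (corner pos n p e i) (corner pos n p e (i + 1)) =
      side (fun x => x.1) z (corner pos n p e 0) (corner pos n p e 1) := by
  induction i with
  | zero => rfl
  | succ i ih =>
    rw [← ih (by omega)]
    symm
    apply side_eq_side_of_degree_two h.isStraightLine_subdivision hz _ (h.adj_inner_corner hi)
    intro hc
    have := h.corner_injOn (by omega) (by omega) hc
    omega

open Classical in
/-- The two sides of the edges of a polygonal drawing, as seen by a circulation: crossing an edge
changes the value by that of the circulation, and around each vertex the edges bounding a given
value are even in number. -/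
theorem exists_sides [Fintype V] [Fintype E] (h : IsPolygonalDrawing tl hd pos n p)
    {Z : Type} [AddCommGroup Z] [Module ℝ Z] {z : E → Module.Dual ℝ Z}
    (hz : ∀ v, ∑ e, ((if tl e = v then z e else 0) - if hd e = v then z e else 0) = 0) :
    ∃ L R : E → Module.Dual ℝ Z, (∀ e, R e = L e - (2 * Real.pi) • z e) ∧
      ∀ v f, Even #{e | (tl e = v ∨ hd e = v) ∧ Xor (L e = f) (R e = f)} := by
  have := finite_corner pos n p
  have := Fintype.ofFinite (Corner pos n p)
  have hP := h.isStraightLine_subdivision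
  have hc := h.isCirculation_lift hz
  set S := side (fun x : Corner pos n p => x.1) (h.lift z) with hS
  set L : E → Module.Dual ℝ Z := fun e => S (corner pos n p e 0) (corner pos n p e 1) with hL
  have hleft : ∀ e i, i < n e → S (corner pos n p e i) (corner pos n p e (i + 1)) = L e :=
    fun e i hi => h.side_corner hc hi
  have hright : ∀ e i, i < n e → S (corner pos n p e (i + 1)) (corner pos n p e i) =
      L e - (2 * Real.pi) • z e := by
    intro e i hi
    rw [hS, side_swap hP hc (h.adj_corner hi), h.lift_corner z hi, ← hS, hleft e i hi]
  refine ⟨L, fun e => L e - (2 * Real.pi) • z e, fun _ => rfl, ?_⟩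
  set R : E → Module.Dual ℝ Z := fun e => L e - (2 * Real.pi) • z e with hR
  intro v f
  set x : Corner pos n p := vertexCorner pos n p v with hx
  -- The corner next to `v` on the edge `e`; it matches the edges at `v` with the neighbours of `x`
  -- in the subdivision.
  set g : E → Corner pos n p := fun e =>
    if tl e = v then corner pos n p e 1 else corner pos n p e (n e - 1) with hg
  have hx0 : ∀ e, tl e = v → x = corner pos n p e 0 := by
    intro e he
    apply Subtype.ext; rw [corner_val _ _ _ (Nat.zero_le _), h.start, he]; rfl
  have hx1 : ∀ e, hd e = v → x = corner pos n p e (n e) := by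
    intro e he
    apply Subtype.ext; rw [corner_val _ _ _ le_rfl, h.finish, he]; rfl
  have hout : ∀ e, tl e = v ∨ hd e = v → S x (g e) = if tl e = v then L e else R e := by
    intro e he
    by_cases ht : tl e = v
    · simp only [hg, ht, if_true]; rw [hx0 e ht]
    · simp only [hg, ht, if_false]
      rw [hx1 e (he.resolve_left ht), show R e = L e - (2 * Real.pi) • z e from rfl, ← hright e (n e - 1) (by have := h.pos_n e; omega),
        Nat.sub_add_cancel (h.pos_n e)]
  have hin : ∀ e, tl e = v ∨ hd e = v → S (g e) x = if tl e = v then R e else L e := by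
    intro e he
    by_cases ht : tl e = v
    · simp only [hg, ht, if_true]; rw [hx0 e ht]; exact hright e 0 (h.pos_n e)
    · simp only [hg, ht, if_false]
      rw [hx1 e (he.resolve_left ht), ← hleft e (n e - 1) (by have := h.pos_n e; omega),
        Nat.sub_add_cancel (h.pos_n e)]
  have hval : ∀ e, tl e = v ∨ hd e = v → ∃ i, i < n e ∧
      s(x.1, (g e).1) = s(p e i, p e (i + 1)) := by
    intro e he
    have hn := h.pos_n e
    by_cases ht : tl e = v
    · refine ⟨0, hn, ?_⟩
      rw [hx0 e ht]; simp only [hg, ht, if_true]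
      rw [corner_val _ _ _ (Nat.zero_le _), corner_val _ _ _ hn]
    · refine ⟨n e - 1, by omega, ?_⟩
      rw [hx1 e (he.resolve_left ht)]; simp only [hg, ht, if_false]
      rw [corner_val _ _ _ le_rfl, corner_val _ _ _ (by omega), Nat.sub_add_cancel hn, Sym2.eq_swap]
  have hinj : ∀ e e', (tl e = v ∨ hd e = v) → (tl e' = v ∨ hd e' = v) → g e = g e' → e = e' := by
    intro e e' he he' hgg
    obtain ⟨i, hi, h1⟩ := hval e he
    obtain ⟨j, hj, h2⟩ := hval e' he'
    exact (h.segment_unique hi hj (by rw [← h1, ← h2, hgg])).1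
  have hsurj : ∀ y, h.subdivision.Adj x y → ∃ e, (tl e = v ∨ hd e = v) ∧ g e = y := by
    rintro y ⟨e, i, hi, hs⟩
    refine ⟨e, ?_⟩
    rw [Sym2.eq_iff] at hs
    rcases hs with ⟨h1, h2⟩ | ⟨h1, h2⟩
    · rcases (h.eq_pos_iff hi.le).mp h1.symm with ⟨rfl, rfl⟩ | ⟨h3, -⟩
      · refine ⟨Or.inl rfl, ?_⟩
        apply Subtype.ext
        simp only [hg, if_true]
        rw [h2, corner_val _ _ _ hi]
      · omega
    · rcases (h.eq_pos_iff hi).mp h1.symm with ⟨h3, -⟩ | ⟨h3, rfl⟩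
      · omega
      · refine ⟨Or.inr rfl, ?_⟩
        apply Subtype.ext
        simp only [hg, h.tl_ne_hd e, if_false]
        rw [h2, corner_val _ _ _ (by omega), ← h3, Nat.succ_sub_one]
  have hadj : ∀ e, tl e = v ∨ hd e = v → h.subdivision.Adj x (g e) := by
    intro e he
    obtain ⟨i, hi, h1⟩ := hval e he
    exact ⟨e, i, hi, h1⟩
  have hcount : ∀ q : Corner pos n p → Prop,
      #{y ∈ h.subdivision.neighborFinset x | q y} =
        #{e | (tl e = v ∨ hd e = v) ∧ q (g e)} := by
    intro q
    symm
    apply Finset.card_nbij g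
    · intro e he
      simp only [coe_filter, mem_univ, true_and, SimpleGraph.mem_neighborFinset,
        Set.mem_ofPred_eq] at he ⊢
      exact ⟨hadj e he.1, he.2⟩
    · intro e he e' he' hee
      simp only [coe_filter, mem_univ, true_and, Set.mem_ofPred_eq] at he he'
      exact hinj e e' he.1 he'.1 hee
    · intro y hy
      simp only [coe_filter, SimpleGraph.mem_neighborFinset, Set.mem_ofPred_eq] at hy
      obtain ⟨e, he, rfl⟩ := hsurj y hy.1
      exact ⟨e, by simpa using ⟨he, hy.2⟩, rfl⟩
  have hmain := card_side_eq hP hc x f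
  rw [← hS, hcount, hcount] at hmain
  set A : Finset E := {e | (tl e = v ∨ hd e = v) ∧ S x (g e) = f} with hA
  set B : Finset E := {e | (tl e = v ∨ hd e = v) ∧ S (g e) x = f} with hB
  have hAB : ({e | (tl e = v ∨ hd e = v) ∧ Xor (L e = f) (R e = f)} : Finset E) =
      symmDiff A B := by
    ext e
    simp only [mem_filter, mem_univ, true_and, Finset.mem_symmDiff, hA, hB]
    by_cases he : tl e = v ∨ hd e = v
    · rw [hout e he, hin e he]
      by_cases ht : tl e = v
      · simp only [ht, if_true, true_or, true_and]; rfl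
      · simp only [ht, if_false, he.resolve_left ht, or_true, true_and, Xor]; tauto
    · simp [he]
  -- The sets `A` and `B` have equal size by `card_side_eq`, so their symmetric difference has even
  -- size.
  rw [hAB, Finset.symmDiff_def, Finset.card_union_of_disjoint disjoint_sdiff_sdiff]
  have h1 := Finset.card_sdiff_add_card_inter A B
  have h2 := Finset.card_sdiff_add_card_inter B A
  rw [Finset.inter_comm] at h2
  exact ⟨#(A \ B), by omega⟩

end Subdivision

end IsPolygonalDrawing

/-! ### Even edge sets and Euler's bound -/

open Classical in
/-- A finite graph with an edge and without vertices of degree one contains a cycle. -/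
theorem not_isAcyclic_of_forall_exists_adj_ne {V : Type} [Finite V] {H : SimpleGraph V} {a b : V}
    (hab : H.Adj a b) (hdeg : ∀ u v, H.Adj u v → ∃ w, H.Adj u w ∧ w ≠ v) : ¬ H.IsAcyclic := by
  intro hac
  have := Fintype.ofFinite V
  have hbound : ∀ k, (∃ (u v : V) (q : H.Walk u v), q.IsPath ∧ q.length = k) →
      k ≤ Fintype.card V := by
    rintro k ⟨u, v, q, hq, rfl⟩
    exact hq.length_lt.le
  have hex : ∃ (u v : V) (q : H.Walk u v), q.IsPath ∧ q.length = 1 :=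
    ⟨a, b, SimpleGraph.Walk.cons hab .nil, by simp [hab.ne], rfl⟩
  -- A longest path: a second neighbour of its first vertex either extends it or closes a cycle.
  have hk := Nat.findGreatest_spec (P := fun k => ∃ (u v : V) (q : H.Walk u v),
    q.IsPath ∧ q.length = k) (hbound 1 hex) hex
  have hk1 := Nat.le_findGreatest (P := fun k => ∃ (u v : V) (q : H.Walk u v),
    q.IsPath ∧ q.length = k) (hbound 1 hex) hex
  set k := Nat.findGreatest (fun k => ∃ (u v : V) (q : H.Walk u v),
    q.IsPath ∧ q.length = k) (Fintype.card V) with hkdef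
  obtain ⟨u, v, q, hq, hlen⟩ := hk
  have hnil : ¬ q.Nil := by
    intro hn
    have := SimpleGraph.Walk.length_eq_zero_iff.mpr hn
    omega
  obtain ⟨w, hw, hne⟩ := hdeg u q.snd (q.adj_snd hnil)
  by_cases hmem : w ∈ q.support
  · exact hne (hac.eq_snd_of_adj_start hq hw hmem)
  · have hp : (SimpleGraph.Walk.cons hw.symm q).IsPath :=
      (SimpleGraph.Walk.cons_isPath_iff _ _).mpr ⟨hq, hmem⟩
    have hex' : ∃ (u v : V) (q : H.Walk u v), q.IsPath ∧ q.length = k + 1 :=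
      ⟨w, v, _, hp, by simp [hlen]⟩
    have := Nat.le_findGreatest (P := fun k => ∃ (u v : V) (q : H.Walk u v),
      q.IsPath ∧ q.length = k) (hbound _ hex') hex'
    omega

-- Even degrees exclude leaves, so a nonempty such subgraph contains a cycle, and a cycle of `G` has
-- at least `g` edges.
open Classical in
theorem le_card_edgeFinset_of_even_degree {V : Type} [Fintype V] {G H : SimpleGraph V} (hHG : H ≤ G)
    {g : ℕ} (hg : (g : ℕ∞) ≤ G.egirth) (hH : H ≠ ⊥) (hdeg : ∀ v, Even (H.degree v)) :
    g ≤ #H.edgeFinset := by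
  obtain ⟨a, b, hab⟩ := SimpleGraph.ne_bot_iff_exists_adj.mp hH
  have hcyc : ¬ H.IsAcyclic := by
    apply not_isAcyclic_of_forall_exists_adj_ne hab
    intro u v huv
    have hpos : 0 < H.degree u := (H.degree_pos_iff_exists_adj u).mpr ⟨v, huv⟩
    have hlt : 1 < #(H.neighborFinset u) := by
      have := hdeg u
      rw [SimpleGraph.card_neighborFinset_eq_degree]
      rcases this with ⟨r, hr⟩
      omega
    obtain ⟨w, hw, hne⟩ := Finset.exists_mem_ne hlt v
    exact ⟨w, by simpa using hw, hne⟩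
  unfold SimpleGraph.IsAcyclic at hcyc
  push Not at hcyc
  obtain ⟨c, w, hw⟩ := hcyc
  have h1 := SimpleGraph.le_egirth.mp (hg.trans (SimpleGraph.egirth_anti hHG)) c w hw
  have h2 : w.length ≤ #H.edgeFinset := by
    rw [← SimpleGraph.Walk.length_edges, ← List.toFinset_card_of_nodup hw.edges_nodup]
    apply Finset.card_le_card
    intro e he
    rw [List.mem_toFinset] at he
    exact SimpleGraph.mem_edgeFinset.mpr (w.edges_subset_edgeSet he)
  exact (Nat.cast_le.mp h1).trans h2

open Classical in
/-- Euler's bound: a drawn graph in which every nonempty even set of edges has at least six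
elements has fewer than `3 / 2` edges per vertex. -/
theorem IsPolygonalDrawing.two_mul_card_lt {V E : Type} [Fintype V] [Fintype E] [Nonempty V]
    {tl hd : E → V} {pos : V → ℂ} {n : E → ℕ} {p : E → ℕ → ℂ}
    (h : IsPolygonalDrawing tl hd pos n p)
    (hcyc : ∀ B : Finset E, B.Nonempty → (∀ v, Even #{e ∈ B | tl e = v ∨ hd e = v}) → 6 ≤ #B) :
    2 * Fintype.card E < 3 * Fintype.card V := by
  -- The boundary operator, whose kernel is the cycle space. Its values have coordinate sum zero, so
  -- its rank is at most `|V| - 1`.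
  set D : (E → ℝ) →ₗ[ℝ] (V → ℝ) := LinearMap.pi fun v =>
    ∑ e, ((if tl e = v then LinearMap.proj e else 0) - if hd e = v then LinearMap.proj e else 0)
    with hD
  have hDapp : ∀ x v, D x v =
      ∑ e, ((if tl e = v then x e else 0) - if hd e = v then x e else 0) := by
    intro x v
    simp only [hD, LinearMap.pi_apply, LinearMap.sum_apply, LinearMap.sub_apply]
    refine Finset.sum_congr rfl fun e _ => ?_
    congr 1 <;> split_ifs <;> rfl
  have hrange : LinearMap.range D ≠ ⊤ := by
    intro htop
    obtain ⟨v₀⟩ := ‹Nonempty V›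
    obtain ⟨x, hx⟩ := LinearMap.range_eq_top.mp htop (Pi.single v₀ 1)
    have h1 : ∑ v, D x v = 0 := by
      simp only [hDapp]
      rw [Finset.sum_comm]
      apply Finset.sum_eq_zero
      intro e _
      simp
    rw [hx] at h1
    simp at h1
  have hrank := Submodule.finrank_lt hrange
  have hnull := LinearMap.finrank_range_add_finrank_ker D
  rw [Module.finrank_fintype_fun_eq_card] at hrank hnull
  set Z := LinearMap.ker D with hZ
  -- The universal circulation: evaluating it at an element of `Z` returns that element.
  set z : E → Module.Dual ℝ Z := fun e => (LinearMap.proj e).comp Z.subtype with hz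
  have hzapp : ∀ e (x : Z), z e x = x.1 e := fun _ _ => rfl
  -- The case of a forest, where the cycle space is trivial and the rank bound suffices.
  by_cases hall : ∀ e, z e = 0
  · have : Module.finrank ℝ Z = 0 := by
      have hs : Subsingleton Z := by
        refine ⟨fun x y => ?_⟩
        apply Subtype.ext
        funext e
        rw [← hzapp, ← hzapp, hall]; rfl
      exact Module.finrank_zero_of_subsingleton
    omega
  push Not at hall
  have hcons : ∀ v, ∑ e, ((if tl e = v then z e else 0) - if hd e = v then z e else 0) = 0 := by
    intro v
    ext x
    have hx : D x.1 v = 0 := by rw [LinearMap.mem_ker.mp x.2]; rfl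
    rw [hDapp] at hx
    rw [LinearMap.zero_apply, ← hx, LinearMap.sum_apply]
    refine Finset.sum_congr rfl fun e _ => ?_
    rw [LinearMap.sub_apply]
    congr 1 <;> split_ifs <;> rfl
  obtain ⟨L, R, hR, heven⟩ := h.exists_sides hcons
  have hpi : (2 * Real.pi) ≠ 0 := by positivity
  have hLR : ∀ e, z e ≠ 0 → L e ≠ R e := by
    intro e he heq
    rw [hR, eq_comm, sub_eq_self, smul_eq_zero] at heq
    exact heq.elim hpi he
  set S : Finset E := {e | z e ≠ 0} with hS
  set F : Finset (Module.Dual ℝ Z) := S.image L ∪ S.image R with hF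
  have hLF : ∀ e, z e ≠ 0 → L e ∈ F := fun e he =>
    Finset.mem_union_left _ (Finset.mem_image_of_mem _ (by simpa [hS] using he))
  have hRF : ∀ e, z e ≠ 0 → R e ∈ F := fun e he =>
    Finset.mem_union_right _ (Finset.mem_image_of_mem _ (by simpa [hS] using he))
  -- If `f x + c = 0` for all values `f`, then the two sides of each edge agree at `x`, so every
  -- coordinate of `x` vanishes, and then `c = 0`.
  have hfaces : Module.finrank ℝ Z + 1 ≤ #F := by
    set Φ : (Z × ℝ) →ₗ[ℝ] (F → ℝ) := LinearMap.pi fun f =>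
      f.1.comp (LinearMap.fst ℝ Z ℝ) + LinearMap.snd ℝ Z ℝ with hΦ
    have hinj : Function.Injective Φ := by
      rw [← LinearMap.ker_eq_bot, LinearMap.ker_eq_bot']
      rintro ⟨x, c⟩ hxc
      have hval : ∀ f ∈ F, f x + c = 0 := fun f hf => congrFun hxc ⟨f, hf⟩
      have hx : x = 0 := by
        apply Subtype.ext
        funext e
        rw [← hzapp]
        by_cases he : z e = 0
        · rw [he]; rfl
        · have h1 := hval _ (hLF e he)
          have h2 := hval _ (hRF e he)
          rw [hR, LinearMap.sub_apply, LinearMap.smul_apply, smul_eq_mul] at h2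
          have : (2 * Real.pi) * z e x = 0 := by linarith
          exact (mul_eq_zero.mp this).resolve_left hpi
      obtain ⟨e, he⟩ := hall
      have h1 := hval _ (hLF e he)
      rw [hx, map_zero, zero_add] at h1
      rw [hx, h1]; rfl
    have := LinearMap.finrank_le_finrank_of_injective hinj
    rw [Module.finrank_prod, Module.finrank_self, Module.finrank_fintype_fun_eq_card,
      Fintype.card_coe] at this
    exact this
  have hB : ∀ f ∈ F, 6 ≤ #{e : E | Xor (L e = f) (R e = f)} := by
    intro f hf
    apply hcyc
    · rw [hF, Finset.mem_union, Finset.mem_image, Finset.mem_image] at hf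
      rcases hf with ⟨e, he, rfl⟩ | ⟨e, he, rfl⟩
      · refine ⟨e, ?_⟩
        have := hLR e (by simpa [hS] using he)
        exact Finset.mem_filter.mpr ⟨Finset.mem_univ e, Or.inl ⟨rfl, this.symm⟩⟩
      · refine ⟨e, ?_⟩
        have := hLR e (by simpa [hS] using he)
        exact Finset.mem_filter.mpr ⟨Finset.mem_univ e, Or.inr ⟨rfl, this⟩⟩
    · intro v
      rw [Finset.filter_filter]
      simp only [and_comm (a := Xor _ _)]
      exact heven v f
  have hdouble : ∑ f ∈ F, #{e : E | Xor (L e = f) (R e = f)} ≤ Fintype.card E * 2 := by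
    refine (Finset.sum_card_bipartiteAbove_eq_sum_card_bipartiteBelow (s := F) (t := Finset.univ)
      (r := fun f e => Xor (L e = f) (R e = f))).trans_le ?_
    rw [← Finset.card_univ]
    apply Finset.sum_le_card_nsmul
    intro e _
    refine (Finset.card_le_card (t := {L e, R e}) ?_).trans Finset.card_le_two
    intro f hf
    rw [Finset.bipartiteBelow, Finset.mem_filter] at hf
    rw [Finset.mem_insert, Finset.mem_singleton]
    rcases hf.2 with ⟨h1, -⟩ | ⟨h1, -⟩
    · exact Or.inl h1.symm
    · exact Or.inr h1.symm
  have hsix := Finset.card_nsmul_le_sum F _ 6 hB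
  rw [smul_eq_mul] at hsix
  -- From `6 (dim Z + 1) ≤ 6 #F ≤ 2 |E|` and `dim Z ≥ |E| - |V| + 1`.
  omega

/-! ### From planar graphs to polygonal drawings in ℂ -/

namespace PushColoring

/-- The identification of the Euclidean plane with the complex numbers. -/
noncomputable def planeToComplex : Plane →ₗ[ℝ] ℂ where
  toFun x := ⟨x 0, x 1⟩
  map_add' x y := by apply Complex.ext <;> simp
  map_smul' c x := by apply Complex.ext <;> simp

theorem planeToComplex_injective : Function.Injective planeToComplex := by
  intro x y hxy
  have h0 := congrArg Complex.re hxy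
  have h1 := congrArg Complex.im hxy
  ext i
  fin_cases i
  · exact h0
  · exact h1

theorem segment_planeToComplex (a b : Plane) :
    segment ℝ (planeToComplex a) (planeToComplex b) = planeToComplex '' segment ℝ a b :=
  (image_segment ℝ planeToComplex.toAffineMap a b).symm

theorem IsPlanar.exists_isPolygonalDrawing {V : Type} {G : SimpleGraph V} (hG : IsPlanar G) :
    ∃ (tl hd : G.edgeSet → V) (pos : V → ℂ) (n : G.edgeSet → ℕ) (p : G.edgeSet → ℕ → ℂ),
      IsPolygonalDrawing tl hd pos n p ∧ ∀ e, e.1 = s(tl e, hd e) := by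
  obtain ⟨pos, arc, hinj, harc, hvert, hcross⟩ := hG
  have hends : ∀ e : G.edgeSet, ∃ u v, e.1 = s(u, v) := by
    rintro ⟨e, he⟩
    induction e with
    | h u v => exact ⟨u, v, rfl⟩
  choose tl hd hends using hends
  have hadj : ∀ e, G.Adj (tl e) (hd e) := fun e => by
    have := e.2
    rwa [hends e] at this
  have hpoly := fun e => harc _ _ (hadj e)
  choose n p hn h0 hlast hnd hcon hdis harc using hpoly
  have hsub : ∀ e i, i < n e → segment ℝ (p e i) (p e (i + 1)) ⊆ arc e.1 := by
    intro e i hi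
    rw [hends e, harc e]
    exact Set.subset_biUnion_of_mem (u := fun i => segment ℝ (p e i) (p e (i + 1)))
      (show i ∈ Set.Iio (n e) from hi)
  refine ⟨tl, hd, fun v => planeToComplex (pos v), n, fun e i => planeToComplex (p e i), ?_, hends⟩
  exact
  { inj := planeToComplex_injective.comp hinj
    simple := fun e f h => Subtype.ext (by rw [hends e, hends f, h])
    pos_n := hn
    start := fun e => by rw [h0]
    finish := fun e => by rw [hlast]
    nondeg := fun e i hi h => hnd e i hi (planeToComplex_injective h)
    consec := fun e i hi => by
      rw [segment_planeToComplex, segment_planeToComplex,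
        ← Set.image_inter planeToComplex_injective, hcon e i hi, Set.image_singleton]
    disj := fun e i j hij hj => by
      rw [segment_planeToComplex, segment_planeToComplex]
      exact (Set.disjoint_image_iff planeToComplex_injective).mpr (hdis e i j hij hj)
    vert := fun e i w hi hw => by
      rw [segment_planeToComplex, planeToComplex_injective.mem_set_image] at hw
      have := hvert e.1 e.2 w (hsub e i hi hw)
      rwa [hends e, Sym2.mem_iff] at this
    cross := fun e f i j hef hi hj x hx hx' => by
      rw [segment_planeToComplex] at hx hx'
      obtain ⟨y, hy, rfl⟩ := hx
      rw [planeToComplex_injective.mem_set_image] at hx'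
      obtain ⟨w, -, hw⟩ := hcross e.1 e.2 f.1 f.2 (fun h => hef (Subtype.ext h))
        ⟨hsub e i hi hy, hsub f j hj hx'⟩
      exact ⟨w, by rw [hw]⟩ }

open Classical in
theorem two_mul_card_edgeFinset_lt {V : Type} [Fintype V] [Nonempty V] {G : SimpleGraph V}
    (hG : IsPlanar G) (hg : (6 : ℕ) ≤ G.egirth) : 2 * #G.edgeFinset < 3 * Fintype.card V := by
  obtain ⟨tl, hd, pos, n, p, h, hends⟩ := hG.exists_isPolygonalDrawing
  have := h.two_mul_card_lt fun B hB heven => by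
    set s : Finset (Sym2 V) := B.map (Function.Embedding.subtype _) with hs
    have hsG : ∀ e ∈ s, e ∈ G.edgeSet := by
      intro e he
      obtain ⟨e', -, rfl⟩ := Finset.mem_map.mp he
      exact e'.2
    obtain ⟨H, hHset⟩ : ∃ H : SimpleGraph V, H.edgeSet = s := by
      refine ⟨SimpleGraph.fromEdgeSet s, ?_⟩
      rw [SimpleGraph.edgeSet_fromEdgeSet, sdiff_eq_left, Set.disjoint_left]
      exact fun e he => G.not_isDiag_of_mem_edgeSet (hsG e he)
    have hHfin : H.edgeFinset = s := by
      rw [← Finset.coe_inj, SimpleGraph.coe_edgeFinset, hHset]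
    have hle : H ≤ G := by
      rw [← SimpleGraph.edgeSet_subset_edgeSet, hHset]; exact hsG
    rw [← Finset.card_map (Function.Embedding.subtype _), ← hs, ← hHfin]
    apply le_card_edgeFinset_of_even_degree hle hg
    · intro hbot
      rw [hbot, SimpleGraph.edgeSet_bot, eq_comm, Finset.coe_eq_empty, hs,
        Finset.map_eq_empty] at hHset
      exact hB.ne_empty hHset
    · intro v
      rw [← SimpleGraph.card_incidenceFinset_eq_degree, SimpleGraph.incidenceFinset_eq_filter,
        hHfin, hs, Finset.filter_map, Finset.card_map]
      convert heven v using 4 with e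
      simp only [Function.comp, Function.Embedding.subtype_apply]
      rw [hends e, Sym2.mem_iff]
      exact or_congr eq_comm eq_comm
  rwa [← SimpleGraph.edgeFinset_card] at this

end PushColoring

/-! ### Colouring by the signed Paley tournament -/

namespace PushColoring

/-- The Paley tournament on seven vertices. -/
def paley : OrientedGraph (Fin 7) where
  Adj x y := y - x = 1 ∨ y - x = 2 ∨ y - x = 4
  asymm := by decide

/-- `x` may be the colour of the tail (if `b`) or head (if not `b`) of an arc whose other end has
colour `y`. A colour is a vertex of the Paley tournament with a sign telling whether to push. -/
def Compat (b : Bool) (x y : Fin 7 × Bool) : Prop :=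
  if b = (x.2 == y.2) then paley.Adj x.1 y.1 else paley.Adj y.1 x.1

instance : DecidableRel paley.Adj := fun x y =>
  inferInstanceAs (Decidable (y - x = 1 ∨ y - x = 2 ∨ y - x = 4))

instance (b : Bool) : DecidableRel (Compat b) := fun x y =>
  inferInstanceAs (Decidable (if b = (x.2 == y.2) then paley.Adj x.1 y.1 else paley.Adj y.1 x.1))

theorem compat_symm : ∀ (b : Bool) (x y : Fin 7 × Bool), Compat b x y → Compat (!b) y x := by
  decide +kernel

theorem six_le_card_compat : ∀ (b : Bool) (x : Fin 7 × Bool), 6 ≤ #{y | Compat b y x} := by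
  decide +kernel

/-- Two colours over the same Paley vertex impose equal or contradictory constraints. Over distinct
vertices, a sign flip merges each adjacency pattern with its opposite: one common out-neighbour and
one common in-neighbour give 2 colours, and the three remaining vertices give 3. -/
theorem two_le_card_compat : ∀ (b b' : Bool) (x x' : Fin 7 × Bool),
    (∃ y, Compat b y x ∧ Compat b' y x') → 2 ≤ #{y | Compat b y x ∧ Compat b' y x'} := by
  decide +kernel

/-- Only contradictory constraints leave no `t`, which forces `y` to lie over the same Paley vertex
as `x`, with one particular sign. -/
theorem card_not_compat_le_one : ∀ (b b' : Bool) (x : Fin 7 × Bool),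
    #{y | ¬ ∃ t, Compat b t y ∧ Compat b' t x} ≤ 1 := by
  decide +kernel

section Extension

set_option linter.unusedSectionVars false

variable {V : Type} {G : SimpleGraph V} {b : V → V → Bool} {S : Finset V}

open Classical in
/-- The neighbours of `v` inside `S`. -/
noncomputable def nbhd (G : SimpleGraph V) (S : Finset V) (v : V) : Finset V := {u ∈ S | G.Adj v u}

theorem mem_nbhd {u v : V} : u ∈ nbhd G S v ↔ u ∈ S ∧ G.Adj v u := by simp [nbhd]

/-- `k` is a pushable colouring of the part of `G` induced by `S`; `b` encodes the orientation. -/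
def IsColoring (G : SimpleGraph V) (b : V → V → Bool) (S : Finset V) (k : V → Fin 7 × Bool) :
    Prop := ∀ u ∈ S, ∀ v ∈ S, G.Adj u v → Compat (b u v) (k u) (k v)

theorem compat_comm (hb : ∀ u v, G.Adj u v → b v u = !b u v) {k : V → Fin 7 × Bool} {u v : V}
    (h : G.Adj u v) (hc : Compat (b u v) (k u) (k v)) : Compat (b v u) (k v) (k u) := by
  rw [hb u v h]; exact compat_symm _ _ _ hc

open Classical in
theorem IsColoring.update (hb : ∀ u v, G.Adj u v → b v u = !b u v) {k : V → Fin 7 × Bool} {v : V}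
    (hk : IsColoring G b (S.erase v) k) {y : Fin 7 × Bool}
    (hy : ∀ u ∈ nbhd G S v, Compat (b v u) y (k u)) : IsColoring G b S (Function.update k v y) := by
  have key : ∀ u ∈ S, G.Adj v u →
      Compat (b v u) (Function.update k v y v) (Function.update k v y u) := by
    intro u hu hvu
    rw [Function.update_self, Function.update_of_ne hvu.ne']
    exact hy u (mem_nbhd.mpr ⟨hu, hvu⟩)
  intro u hu w hw huw
  by_cases h1 : u = v
  · subst h1; exact key w hw huw
  by_cases h2 : w = v
  · subst h2; exact compat_comm hb huw.symm (key u hu huw.symm)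
  · rw [Function.update_of_ne h1, Function.update_of_ne h2]
    exact hk u (mem_erase.mpr ⟨h1, hu⟩) w (mem_erase.mpr ⟨h2, hw⟩) huw

theorem IsColoring.mono {T : Finset V} {k : V → Fin 7 × Bool} (hk : IsColoring G b S k)
    (h : T ⊆ S) : IsColoring G b T k :=
  fun u hu v hv huv => hk u (h hu) v (h hv) huv

theorem six_le_card_of_card_le_one (b : V → Bool) (k : V → Fin 7 × Bool) {N : Finset V}
    (hN : #N ≤ 1) : 6 ≤ #{y | ∀ u ∈ N, Compat (b u) y (k u)} := by
  rcases Finset.eq_empty_or_nonempty N with rfl | ⟨u, hu⟩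
  · simp
  · refine (six_le_card_compat (b u) (k u)).trans (Finset.card_le_card ?_)
    intro y hy
    simp only [mem_filter, mem_univ, true_and] at hy ⊢
    intro w hw
    rw [Finset.card_le_one.mp hN w hw u hu]; exact hy

theorem two_le_card_of_card_le_two (b : V → Bool) (k : V → Fin 7 × Bool) {N : Finset V}
    (hN : #N ≤ 2) (hex : ∃ y, ∀ u ∈ N, Compat (b u) y (k u)) :
    2 ≤ #{y | ∀ u ∈ N, Compat (b u) y (k u)} := by
  classical
  rcases hN.lt_or_eq with hN | hN
  · have : 6 ≤ #{y | ∀ u ∈ N, Compat (b u) y (k u)} := by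
      exact six_le_card_of_card_le_one b k (by omega)
    omega
  · obtain ⟨u, w, -, rfl⟩ := Finset.card_eq_two.mp hN
    have := two_le_card_compat (b u) (b w) (k u) (k w) (by simpa using hex)
    simpa using this

-- Uncolour `X` and recolour `v`. Its neighbours outside `X` leave at least 6 colours if there is at
-- most one of them, and at least 2 if there are two. Each vertex of `X` spoils at most one of
-- these, so some choice at `v` extends to all of `X`, which is independent since there are no
-- triangles.
open Classical in
theorem exists_coloring_of_two_neighbors (hb : ∀ u v, G.Adj u v → b v u = !b u v)
    (htri : ∀ u v w, G.Adj u v → G.Adj v w → ¬ G.Adj u w) {v : V} (hv : v ∈ S) {X : Finset V}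
    (hX : X ⊆ nbhd G S v) (hdeg : ∀ x ∈ X, #(nbhd G S x) = 2)
    (hcard : (#(nbhd G S v) ≤ #X + 1 ∧ #X ≤ 5) ∨ (#(nbhd G S v) ≤ #X + 2 ∧ #X ≤ 1))
    {k : V → Fin 7 × Bool} (hk : IsColoring G b (S \ X) k) : ∃ k', IsColoring G b S k' := by
  have hvX : v ∉ X := fun h => (mem_nbhd.mp (hX h)).2.ne rfl
  have hXadj : ∀ x ∈ X, G.Adj v x := fun x hx => (mem_nbhd.mp (hX hx)).2
  have hXind : ∀ x ∈ X, ∀ x' ∈ X, ¬ G.Adj x x' := fun x hx x' hx' =>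
    htri x v x' (hXadj x hx).symm (hXadj x' hx')
  have hother : ∀ x ∈ X, ∃ o, ∀ u ∈ nbhd G S x, u = v ∨ u = o := by
    intro x hx
    obtain ⟨p, q, -, hpq⟩ := Finset.card_eq_two.mp (hdeg x hx)
    have : v ∈ nbhd G S x := mem_nbhd.mpr ⟨hv, (hXadj x hx).symm⟩
    rw [hpq, Finset.mem_insert, Finset.mem_singleton] at this
    rcases this with rfl | rfl
    · exact ⟨q, fun u hu => by rw [hpq] at hu; simpa using hu⟩
    · exact ⟨p, fun u hu => by rw [hpq] at hu; simpa [or_comm] using hu⟩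
  choose! o ho using hother
  set N := nbhd G S v \ X with hN
  set A : Finset (Fin 7 × Bool) := {y | ∀ u ∈ N, Compat (b v u) y (k u)} with hA
  have hNcard : #N = #(nbhd G S v) - #X := Finset.card_sdiff_of_subset hX
  have hlt : #X < #A := by
    rcases hcard with ⟨h1, h2⟩ | ⟨h1, h2⟩
    · have : 6 ≤ #A := six_le_card_of_card_le_one (b v) k (by omega)
      omega
    · have : 2 ≤ #A := by
        apply two_le_card_of_card_le_two (b v) k (by omega)
        -- The old colour of `v` shows that the two constraints are not contradictory.
        refine ⟨k v, fun u hu => ?_⟩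
        rw [hN, mem_sdiff, mem_nbhd] at hu
        exact hk v (mem_sdiff.mpr ⟨hv, hvX⟩) u (mem_sdiff.mpr ⟨hu.1.1, hu.2⟩) hu.1.2
      omega
  set bad : V → Finset (Fin 7 × Bool) := fun x =>
    {y | ¬ ∃ t, Compat (b x v) t y ∧ Compat (b x (o x)) t (k (o x))} with hbad
  have hbadcard : #(X.biUnion bad) ≤ #X := by
    have := Finset.card_biUnion_le_card_mul X bad 1 fun x _ => card_not_compat_le_one _ _ _
    omega
  obtain ⟨y, hyA, hyB⟩ := Finset.exists_mem_notMem_of_card_lt_card (hbadcard.trans_lt hlt)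
  have hyA' : ∀ u ∈ N, Compat (b v u) y (k u) := (Finset.mem_filter.mp hyA).2
  have hext : ∀ x ∈ X, ∃ t, Compat (b x v) t y ∧ Compat (b x (o x)) t (k (o x)) := by
    intro x hx
    by_contra hc
    exact hyB (Finset.mem_biUnion.mpr ⟨x, hx, Finset.mem_filter.mpr ⟨Finset.mem_univ _, hc⟩⟩)
  choose! t ht using hext
  have hk1 : IsColoring G b (S \ X) (Function.update k v y) := by
    apply IsColoring.update hb (hk.mono (Finset.erase_subset _ _))
    intro u hu
    apply hyA'
    rw [mem_nbhd, mem_sdiff] at hu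
    rw [hN, mem_sdiff, mem_nbhd]
    exact ⟨⟨hu.1.1, hu.2⟩, hu.1.2⟩
  set k' : V → Fin 7 × Bool := fun u => if u ∈ X then t u else Function.update k v y u with hk'
  have key : ∀ x ∈ X, ∀ u ∈ S, G.Adj x u → Compat (b x u) (k' x) (k' u) := by
    intro x hx u hu hxu
    have huX : u ∉ X := fun h => hXind x hx u h hxu
    simp only [hk', hx, huX, if_true, if_false]
    by_cases huv : u = v
    · subst huv
      rw [Function.update_self]; exact (ht x hx).1
    · rw [Function.update_of_ne huv]
      rw [(ho x hx u (mem_nbhd.mpr ⟨hu, hxu⟩)).resolve_left huv]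
      exact (ht x hx).2
  refine ⟨k', fun u hu w hw huw => ?_⟩
  by_cases h1 : u ∈ X
  · exact key u h1 w hw huw
  by_cases h2 : w ∈ X
  · exact compat_comm hb huw.symm (key w h2 u hu huw.symm)
  · simp only [hk', h1, h2, if_false]
    exact hk1 u (mem_sdiff.mpr ⟨hu, h1⟩) w (mem_sdiff.mpr ⟨hw, h2⟩) huw

open Classical in
/-- Triangle-free graphs all of whose subgraphs have average degree less than three are
colourable. -/
theorem exists_isColoring (hb : ∀ u v, G.Adj u v → b v u = !b u v)
    (htri : ∀ u v w, G.Adj u v → G.Adj v w → ¬ G.Adj u w)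
    (hmad : ∀ S : Finset V, S.Nonempty → ∑ v ∈ S, #(nbhd G S v) < 3 * #S) (S : Finset V) :
    ∃ k, IsColoring G b S k := by
  induction S using Finset.strongInduction with
  | H S ih =>
  by_contra hno
  have hne : S.Nonempty := by
    rw [Finset.nonempty_iff_ne_empty]
    rintro rfl
    exact hno ⟨fun _ => (0, true), fun u hu => by simp at hu⟩
  have hred : ∀ v ∈ S, ∀ X ⊆ nbhd G S v, X.Nonempty → (∀ x ∈ X, #(nbhd G S x) = 2) →
      ¬ ((#(nbhd G S v) ≤ #X + 1 ∧ #X ≤ 5) ∨ (#(nbhd G S v) ≤ #X + 2 ∧ #X ≤ 1)) := by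
    intro v hv X hX hXne hdeg hcard
    have hss : S \ X ⊂ S := Finset.sdiff_ssubset (fun x hx => (mem_nbhd.mp (hX hx)).1) hXne
    obtain ⟨k, hk⟩ := ih _ hss
    exact hno (exists_coloring_of_two_neighbors hb htri hv hX hdeg hcard hk)
  have htwo : ∀ v ∈ S, 2 ≤ #(nbhd G S v) := by
    intro v hv
    by_contra hlt
    obtain ⟨k, hk⟩ := ih _ (Finset.erase_ssubset hv)
    have h6 := six_le_card_of_card_le_one (b v) k (N := nbhd G S v) (by omega)
    obtain ⟨y, hy⟩ := Finset.card_pos.mp (show 0 < #{y | ∀ u ∈ nbhd G S v, Compat (b v u) y (k u)}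
      by omega)
    exact hno ⟨_, hk.update hb (Finset.mem_filter.mp hy).2⟩
  set T : Finset V := {x ∈ S | #(nbhd G S x) = 2} with hT
  set t : V → Finset V := fun v => {x ∈ nbhd G S v | #(nbhd G S x) = 2} with ht
  -- Reducibility with a single vertex of degree two in `X` excludes degrees 2 and 3.
  have hfour : ∀ v ∈ S, (t v).Nonempty → 4 ≤ #(nbhd G S v) := by
    rintro v hv ⟨x, hx⟩
    rw [ht, mem_filter] at hx
    have := hred v hv {x} (by simpa using hx.1) (Finset.singleton_nonempty x) (by simpa using hx.2)
    simp only [Finset.card_singleton] at this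
    omega
  -- Discharging with initial charge `2 d - 6`: each vertex gives 1 to every neighbour of degree
  -- two, and a vertex of degree two thus receives 2. All final charges are nonnegative.
  have hlocal : ∀ v ∈ S, 6 + #(t v) ≤ 2 * #(nbhd G S v) + if #(nbhd G S v) = 2 then 2 else 0 := by
    intro v hv
    have h2 := htwo v hv
    have htle : #(t v) ≤ #(nbhd G S v) := Finset.card_filter_le _ _
    rcases Finset.eq_empty_or_nonempty (t v) with h0 | h0
    · rw [h0, Finset.card_empty]
      split_ifs <;> omega
    have h4 := hfour v hv h0
    rw [if_neg (by omega)]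
    have hsub : ∀ m, 0 < m → m ≤ 5 → m ≤ #(t v) → ¬ #(nbhd G S v) ≤ m + 1 := by
      intro m hm hm5 hmt hle
      obtain ⟨X, hX, hXm⟩ := Finset.exists_subset_card_eq hmt
      refine hred v hv X (hX.trans (Finset.filter_subset _ _)) (Finset.card_pos.mp (by omega))
        (fun x hx => (Finset.mem_filter.mp (hX hx)).2) (Or.inl (by omega))
    -- `m = 3` leaves a vertex of degree 4 at most two neighbours of degree two, and `m = 5` leaves
    -- one of degree 5 at most four. From degree 6 on, `d ≤ 2 d - 6` suffices.
    have h3 := hsub 3 (by omega) (by omega)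
    have h5 := hsub 5 (by omega) (by omega)
    omega
  have hsum := Finset.sum_le_sum hlocal
  have hcount : ∑ v ∈ S, #(t v) = 2 * #T := by
    have h1 : ∀ v ∈ S, t v = T.bipartiteAbove G.Adj v := by
      intro v _
      ext x
      simp only [ht, hT, Finset.bipartiteAbove, mem_filter, mem_nbhd]
      tauto
    have h2 : ∀ x ∈ T, #(S.bipartiteBelow G.Adj x) = 2 := by
      intro x hx
      rw [← (Finset.mem_filter.mp hx).2]
      congr 1
      ext v
      simp [Finset.bipartiteBelow, mem_nbhd, G.adj_comm]
    rw [Finset.sum_congr rfl fun v hv => by rw [h1 v hv],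
      Finset.sum_card_bipartiteAbove_eq_sum_card_bipartiteBelow, Finset.sum_congr rfl h2,
      Finset.sum_const, smul_eq_mul, mul_comm]
  have hif : ∑ v ∈ S, (if #(nbhd G S v) = 2 then 2 else 0) = 2 * #T := by
    rw [← Finset.sum_filter, Finset.sum_const, smul_eq_mul, mul_comm]
  have hm := hmad S hne
  rw [Finset.sum_add_distrib, Finset.sum_add_distrib, hcount, hif, ← Finset.mul_sum,
    Finset.sum_const, smul_eq_mul] at hsum
  omega

end Extension

end PushColoring

/-! ### Upper bound: sparsity of subgraphs, and pushing a set of vertices -/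

namespace PushColoring

theorem IsPlanar.induce {V : Type} {G : SimpleGraph V} (hG : IsPlanar G) (S : Set V) :
    IsPlanar (G.induce S) := by
  obtain ⟨pos, arc, hinj, harc, hvert, hcross⟩ := hG
  have hedge : ∀ e ∈ (G.induce S).edgeSet, e.map Subtype.val ∈ G.edgeSet := by
    intro e he
    induction e with
    | h u v => exact he
  refine ⟨fun v => pos v, fun e => arc (e.map Subtype.val), hinj.comp Subtype.val_injective,
    fun u v huv => harc u v huv, fun e he w hw => ?_, fun e he f hf hef x hx => ?_⟩
  · have := hvert _ (hedge e he) w hw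
    obtain ⟨w', hw', hww⟩ := Sym2.mem_map.mp this
    rwa [← Subtype.ext hww]
  · obtain ⟨w, ⟨h1, h2⟩, rfl⟩ := hcross _ (hedge e he) _ (hedge f hf)
      (fun h => hef (Sym2.map.injective Subtype.val_injective h)) hx
    obtain ⟨w₁, hw₁, rfl⟩ := Sym2.mem_map.mp h1
    obtain ⟨w₂, hw₂, hww⟩ := Sym2.mem_map.mp h2
    rw [Subtype.ext hww] at hw₂
    exact ⟨w₁, ⟨hw₁, hw₂⟩, rfl⟩

open Classical in
theorem sum_card_nbhd_lt {V : Type} {G : SimpleGraph V} (hG : IsPlanar G)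
    (hg : (6 : ℕ) ≤ G.egirth) (S : Finset V) (hS : S.Nonempty) :
    ∑ v ∈ S, #(nbhd G S v) < 3 * #S := by
  have : Nonempty (S : Set V) := hS.to_subtype
  have hgirth : (6 : ℕ) ≤ (G.induce (S : Set V)).egirth :=
    hg.trans (SimpleGraph.IsContained.egirth_le
      ⟨(SimpleGraph.Embedding.induce (S : Set V)).toCopy⟩)
  have h1 := two_mul_card_edgeFinset_lt (hG.induce (S : Set V)) hgirth
  rw [← SimpleGraph.sum_degrees_eq_twice_card_edges] at h1
  have h2 : ∀ (v : (S : Set V)) (_ : Fintype ((G.induce (S : Set V)).neighborSet v)),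
      (G.induce (S : Set V)).degree v = #(nbhd G S v) := by
    intro v _
    rw [← SimpleGraph.card_neighborFinset_eq_degree,
      ← Finset.card_map (Function.Embedding.subtype _)]
    congr 1
    ext u
    simp [mem_nbhd, and_comm]
  simp only [h2] at h1
  have h3 : ∑ v : (S : Set V), #(nbhd G S v) = ∑ v ∈ S, #(nbhd G S v) :=
    Finset.sum_coe_sort S fun v => #(nbhd G S v)
  rw [h3] at h1
  simpa using h1

theorem not_adj_of_lt_egirth {V : Type} {G : SimpleGraph V} (hg : (6 : ℕ) ≤ G.egirth)
    (u v w : V) (huv : G.Adj u v) (hvw : G.Adj v w) : ¬ G.Adj u w := by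
  intro huw
  have hc : (SimpleGraph.Walk.cons huv (.cons hvw (.cons huw.symm .nil))).IsCycle := by
    simp [SimpleGraph.Walk.cons_isCycle_iff, huv.ne, huv.ne', hvw.ne, huw.ne, huw.ne']
  have := hg.trans (SimpleGraph.egirth_le_length hc)
  simp only [SimpleGraph.Walk.length_cons, SimpleGraph.Walk.length_nil] at this
  exact absurd (Nat.cast_le.mp this) (by norm_num)

namespace OrientedGraph

/-- Pushing all vertices `v` with `s v` (simultaneously). -/
def pushAll {V : Type} (O : OrientedGraph V) (s : V → Prop) : OrientedGraph V where
  Adj a b := ((s a ↔ s b) ∧ O.Adj a b) ∨ (¬ (s a ↔ s b) ∧ O.Adj b a)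
  asymm := by
    intro a b h h'
    have h₁ := O.asymm a b
    have h₂ := O.asymm b a
    tauto

theorem ext_adj {V : Type} {O O' : OrientedGraph V} (h : ∀ a b, O.Adj a b ↔ O'.Adj a b) :
    O = O' :=
  OrientedGraph.ext (funext fun a => funext fun b => propext (h a b))

theorem pushRel_pushAll {V : Type} [Finite V] (O : OrientedGraph V) (s : V → Prop) :
    O.PushRel (O.pushAll s) := by
  classical
  have := Fintype.ofFinite V
  have key : ∀ A : Finset V, O.PushRel (O.pushAll (· ∈ A)) := by
    intro A
    induction A using Finset.induction_on with
    | empty =>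
      have : O.pushAll (· ∈ (∅ : Finset V)) = O := ext_adj fun a b => by simp [pushAll]
      rw [this]
      exact Relation.ReflTransGen.refl
    | insert v A hv ih =>
      refine ih.tail ⟨v, ext_adj fun a b => ?_⟩
      simp only [pushAll, push, Finset.mem_insert]
      by_cases ha : a = v <;> by_cases hb : b = v
      · subst ha; subst hb; simp
      · subst ha; simp [hb, hv, or_comm]
      · subst hb; simp [ha, hv, or_comm]
      · simp [ha, hb]
  have h := key {v | s v}
  simpa using h

/-- Pushing twice cancels, so only the parity of the pushes at each vertex matters; one more push
toggles membership of `v`. -/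
theorem exists_eq_pushAll_of_pushRel {V : Type} {O O' : OrientedGraph V} (h : O.PushRel O') :
    ∃ s : V → Prop, O' = O.pushAll s := by
  induction h with
  | refl => exact ⟨fun _ => False, ext_adj fun a b => by simp [pushAll]⟩
  | tail _ hstep ih =>
    obtain ⟨s, rfl⟩ := ih
    obtain ⟨v, rfl⟩ := hstep
    refine ⟨fun a => ¬ (s a ↔ a = v), ext_adj fun a b => ?_⟩
    simp only [pushAll, push]
    by_cases h1 : s a <;> by_cases h2 : s b <;> by_cases ha : a = v <;> by_cases hb : b = v <;>
      simp_all

end OrientedGraph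

theorem chiP_orientation_le {V : Type} {G : SimpleGraph V} (hG : PlanarGirthAtLeast 6 G)
    {O : OrientedGraph V} (hO : O.IsOrientationOf G) : O.chiP ≤ 7 := by
  classical
  obtain ⟨hfin, hpl, hg⟩ := hG
  have := Fintype.ofFinite V
  have hb : ∀ u v, G.Adj u v → decide (O.Adj v u) = !decide (O.Adj u v) := by
    intro u v huv
    rw [← hO] at huv
    rcases huv with h | h
    · simp [h, O.asymm u v h]
    · simp [h, O.asymm v u h]
  obtain ⟨k, hk⟩ := exists_isColoring (b := fun u v => decide (O.Adj u v)) hb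
    (not_adj_of_lt_egirth hg) (sum_card_nbhd_lt hpl hg) Finset.univ
  apply Nat.sInf_le
  refine ⟨paley, fun v => (k v).1, O.pushAll (fun v => (k v).2 = true), O.pushRel_pushAll _, ?_⟩
  intro u v huv
  have hbool : ((k u).2 = true ↔ (k v).2 = true) ↔ true = ((k u).2 == (k v).2) := by
    cases (k u).2 <;> cases (k v).2 <;> simp
  rcases huv with ⟨h1, h2⟩ | ⟨h1, h2⟩
  · have hc := hk u (mem_univ _) v (mem_univ _) (by rw [← hO]; exact Or.inl h2)
    rw [hbool] at h1
    simp only [decide_eq_true h2, Compat] at hc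
    rwa [if_pos h1] at hc
  · have hc := hk u (mem_univ _) v (mem_univ _) (by rw [← hO]; exact Or.inr h2)
    rw [hbool] at h1
    simp only [decide_eq_false (O.asymm v u h2), Compat] at hc
    rwa [if_pos (by revert h1; cases ((k u).2 == (k v).2) <;> simp)] at hc

theorem chiP_le_seven {V : Type} {G : SimpleGraph V} (hG : PlanarGirthAtLeast 6 G) :
    chiP G ≤ 7 := by
  apply csSup_le'
  rintro _ ⟨O, hO, rfl⟩
  exact chiP_orientation_le hG hO

end PushColoring

/-! ### Lower bound: a straight-line drawing of the subdivided `K₄` -/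

namespace PushColoring

/-- The signed area spanned by three points. -/
def cross {R : Type} [CommRing R] (a b c : R × R) : R :=
  (b.1 - a.1) * (c.2 - a.2) - (b.2 - a.2) * (c.1 - a.1)

/-- The point of the plane with given coordinates. -/
noncomputable def toPlane (a : ℝ × ℝ) : Plane := !₂[a.1, a.2]

theorem toPlane_injective : Function.Injective toPlane := by
  intro a b h
  have h0 := congrArg (fun x : Plane => x 0) h
  have h1 := congrArg (fun x : Plane => x 1) h
  exact Prod.ext (by simpa [toPlane] using h0) (by simpa [toPlane] using h1)

theorem mem_segment_toPlane {a b : ℝ × ℝ} {x : Plane} (hx : x ∈ segment ℝ (toPlane a) (toPlane b)) :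
    ∃ s t : ℝ, 0 ≤ s ∧ 0 ≤ t ∧ s + t = 1 ∧
      x = toPlane (s * a.1 + t * b.1, s * a.2 + t * b.2) := by
  obtain ⟨s, t, hs, ht, hst, rfl⟩ := hx
  refine ⟨s, t, hs, ht, hst, ?_⟩
  ext i
  fin_cases i <;> simp [toPlane]

/-- The points `c` and `d` lie strictly on one side of the line through `a` and `b`. -/
theorem disjoint_segment_of_cross {a b c d : ℝ × ℝ} (h : 0 < cross a b c * cross a b d) :
    Disjoint (segment ℝ (toPlane a) (toPlane b)) (segment ℝ (toPlane c) (toPlane d)) := by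
  rw [Set.disjoint_left]
  intro x hx hx'
  obtain ⟨s, t, hs, ht, hst, rfl⟩ := mem_segment_toPlane hx
  obtain ⟨s', t', hs', ht', hst', heq⟩ := mem_segment_toPlane hx'
  have := toPlane_injective heq
  rw [Prod.mk.injEq] at this
  obtain ⟨h1, h2⟩ := this
  have hz : s' * cross a b c + t' * cross a b d = 0 := by
    obtain rfl : s = 1 - t := by linarith
    obtain rfl : s' = 1 - t' := by linarith
    unfold cross
    linear_combination (b.2 - a.2) * h1 - (b.1 - a.1) * h2
  have hpos : 0 < s' * (cross a b c * cross a b c) + t' * (cross a b c * cross a b d) := by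
    have hne : cross a b c ≠ 0 := left_ne_zero_of_mul h.ne'
    have h3 : 0 < cross a b c * cross a b c := mul_self_pos.mpr hne
    rcases hs'.lt_or_eq with hs' | hs'
    · have := mul_pos hs' h3
      have := mul_nonneg ht' h.le
      linarith
    · have : t' = 1 := by linarith
      rw [← hs', this]; linarith
  have : s' * (cross a b c * cross a b c) + t' * (cross a b c * cross a b d) = 0 := by
    linear_combination cross a b c * hz
  linarith

theorem eq_of_mem_segments_of_cross_ne_zero {a b d : ℝ × ℝ} (h : cross a b d ≠ 0) {x : Plane}
    (hx : x ∈ segment ℝ (toPlane a) (toPlane b)) (hx' : x ∈ segment ℝ (toPlane a) (toPlane d)) :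
    x = toPlane a := by
  obtain ⟨s, t, hs, ht, hst, rfl⟩ := mem_segment_toPlane hx
  obtain ⟨s', t', hs', ht', hst', heq⟩ := mem_segment_toPlane hx'
  have h1 := toPlane_injective heq
  rw [Prod.mk.injEq] at h1
  obtain ⟨h1, h2⟩ := h1
  have hz : t' * cross a b d = 0 := by
    obtain rfl : s = 1 - t := by linarith
    obtain rfl : s' = 1 - t' := by linarith
    unfold cross
    linear_combination (b.2 - a.2) * h1 - (b.1 - a.1) * h2
  have ht0 : t' = 0 := (mul_eq_zero.mp hz).resolve_right h
  have hs1 : s' = 1 := by linarith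
  rw [heq, ht0, hs1]
  simp

theorem cross_eq_zero_of_mem_segment {a b c : ℝ × ℝ}
    (h : toPlane c ∈ segment ℝ (toPlane a) (toPlane b)) : cross a b c = 0 := by
  obtain ⟨s, t, hs, ht, hst, heq⟩ := mem_segment_toPlane h
  have := toPlane_injective heq
  rw [this]
  obtain rfl : s = 1 - t := by linarith
  unfold cross
  ring

theorem isPolygonalArc_segment {x y : Plane} (h : x ≠ y) : IsPolygonalArc x y (segment ℝ x y) := by
  refine ⟨1, fun i => if i = 0 then x else y, one_pos, rfl, rfl, ?_, ?_, ?_, ?_⟩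
  · intro i hi
    obtain rfl : i = 0 := by omega
    simpa using h
  · intro i hi; omega
  · intro i j hi hj; omega
  · ext z
    simp

/-- The tournament on four vertices consisting of a cyclic triangle dominated by a source, each arc
replaced by a directed path of length two. -/
def subdividedArcs : List (Fin 10 × Fin 10) :=
  [(0, 4), (4, 1), (0, 5), (5, 2), (0, 6), (6, 3), (1, 7), (7, 2), (2, 8), (8, 3), (3, 9), (9, 1)]

/-- The oriented graph with arcs `subdividedArcs`. -/
def subdividedTournament : OrientedGraph (Fin 10) where
  Adj u v := (u, v) ∈ subdividedArcs
  asymm := by decide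

instance : DecidableRel subdividedTournament.underlying.Adj := fun u v =>
  inferInstanceAs (Decidable ((u, v) ∈ subdividedArcs ∨ (v, u) ∈ subdividedArcs))

/-- Coordinates of a straight-line drawing of `subdividedTournament`. -/
def coord : Fin 10 → ℤ × ℤ :=
  ![(0, 0), (0, 6), (-6, -4), (6, -5), (1, 2), (-2, -3), (3, -3), (-2, 0), (0, -6), (4, -1)]

/-- The placement of the vertices of `subdividedTournament` in the plane. -/
noncomputable def place (v : Fin 10) : Plane := toPlane ((coord v).1, (coord v).2)

theorem cross_cast (a b c : ℤ × ℤ) :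
    cross ((a.1 : ℝ), (a.2 : ℝ)) ((b.1 : ℝ), (b.2 : ℝ)) ((c.1 : ℝ), (c.2 : ℝ)) =
      (cross a b c : ℤ) := by
  unfold cross; push_cast; ring

theorem place_injective : Function.Injective place := by
  intro u v h
  have h1 := toPlane_injective h
  rw [Prod.mk.injEq, Int.cast_inj, Int.cast_inj] at h1
  have key : ∀ u v : Fin 10, (coord u).1 = (coord v).1 → (coord u).2 = (coord v).2 → u = v := by
    decide
  exact key u v h1.1 h1.2

theorem cross_coord_ne_zero : ∀ e ∈ subdividedArcs, ∀ w : Fin 10, w ≠ e.1 → w ≠ e.2 →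
    cross (coord e.1) (coord e.2) (coord w) ≠ 0 := by
  decide +kernel

theorem cross_coord_pos : ∀ e ∈ subdividedArcs, ∀ f ∈ subdividedArcs,
    e.1 ≠ f.1 → e.1 ≠ f.2 → e.2 ≠ f.1 → e.2 ≠ f.2 →
    0 < cross (coord e.1) (coord e.2) (coord f.1) * cross (coord e.1) (coord e.2) (coord f.2) ∨
    0 < cross (coord f.1) (coord f.2) (coord e.1) * cross (coord f.1) (coord f.2) (coord e.2) := by
  decide +kernel

theorem fst_ne_snd_of_mem : ∀ e ∈ subdividedArcs, e.1 ≠ e.2 := by decide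

theorem eq_of_place_mem_segment {e : Fin 10 × Fin 10} (he : e ∈ subdividedArcs) {w : Fin 10}
    (hw : place w ∈ segment ℝ (place e.1) (place e.2)) : w = e.1 ∨ w = e.2 := by
  by_contra hc
  push Not at hc
  have := cross_eq_zero_of_mem_segment hw
  rw [cross_cast, Int.cast_eq_zero] at this
  exact cross_coord_ne_zero e he w hc.1 hc.2 this

theorem disjoint_segment_of_cross_coord {a b c d : Fin 10}
    (h : 0 < cross (coord a) (coord b) (coord c) * cross (coord a) (coord b) (coord d)) :
    Disjoint (segment ℝ (place a) (place b)) (segment ℝ (place c) (place d)) := by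
  apply disjoint_segment_of_cross
  rw [cross_cast, cross_cast]
  exact_mod_cast h

theorem eq_place_of_mem_segments {e f : Fin 10 × Fin 10} (he : e ∈ subdividedArcs)
    (hf : f ∈ subdividedArcs) (hef : s(e.1, e.2) ≠ s(f.1, f.2)) {x : Plane}
    (hx : x ∈ segment ℝ (place e.1) (place e.2)) (hx' : x ∈ segment ℝ (place f.1) (place f.2)) :
    ∃ w, (w = e.1 ∨ w = e.2) ∧ (w = f.1 ∨ w = f.2) ∧ x = place w := by
  have hne : ∀ w, w ≠ e.1 → w ≠ e.2 → ∀ a b, s(a, b) = s(e.1, e.2) →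
      cross (((coord a).1 : ℝ), ((coord a).2 : ℝ)) (((coord b).1 : ℝ), ((coord b).2 : ℝ))
        (((coord w).1 : ℝ), ((coord w).2 : ℝ)) ≠ 0 := by
    intro w h1 h2 a b hab
    rw [cross_cast, Int.cast_ne_zero]
    have := cross_coord_ne_zero e he w h1 h2
    rw [Sym2.eq_iff] at hab
    rcases hab with ⟨rfl, rfl⟩ | ⟨rfl, rfl⟩
    · exact this
    · intro h0
      apply this
      unfold cross at h0 ⊢
      linear_combination -h0
  by_cases h11 : e.1 = f.1
  · refine ⟨e.1, Or.inl rfl, Or.inl h11, ?_⟩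
    rw [← h11] at hx'
    exact eq_of_mem_segments_of_cross_ne_zero
      (hne f.2 (fun h => fst_ne_snd_of_mem f hf (h11.symm.trans h.symm))
        (fun h => hef (by rw [h, h11])) _ _ rfl) hx hx'
  by_cases h12 : e.1 = f.2
  · refine ⟨e.1, Or.inl rfl, Or.inr h12, ?_⟩
    rw [← h12, segment_symm] at hx'
    exact eq_of_mem_segments_of_cross_ne_zero
      (hne f.1 (Ne.symm h11) (fun h => hef (by rw [h, h12, Sym2.eq_swap])) _ _ rfl) hx hx'
  by_cases h21 : e.2 = f.1
  · refine ⟨e.2, Or.inr rfl, Or.inl h21, ?_⟩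
    rw [segment_symm] at hx
    rw [← h21] at hx'
    exact eq_of_mem_segments_of_cross_ne_zero
      (hne f.2 (Ne.symm h12) (fun h => fst_ne_snd_of_mem f hf (h21.symm.trans h.symm)) _ _ Sym2.eq_swap) hx hx'
  by_cases h22 : e.2 = f.2
  · refine ⟨e.2, Or.inr rfl, Or.inr h22, ?_⟩
    rw [segment_symm] at hx
    rw [← h22, segment_symm] at hx'
    exact eq_of_mem_segments_of_cross_ne_zero
      (hne f.1 (Ne.symm h11) (Ne.symm h21) _ _ Sym2.eq_swap) hx hx'
  exfalso
  rcases cross_coord_pos e he f hf h11 h12 h21 h22 with h | h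
  · exact Set.disjoint_left.mp (disjoint_segment_of_cross_coord h) hx hx'
  · exact Set.disjoint_left.mp (disjoint_segment_of_cross_coord h) hx' hx

theorem isPlanar_subdividedTournament : IsPlanar subdividedTournament.underlying := by
  set arc : Sym2 (Fin 10) → Set Plane :=
    Sym2.lift ⟨fun u v => segment ℝ (place u) (place v), fun u v => segment_symm ℝ _ _⟩ with harc
  have hedge : ∀ e ∈ subdividedTournament.underlying.edgeSet, ∃ a ∈ subdividedArcs,
      e = s(a.1, a.2) := by
    intro e he
    induction e with
    | h u v =>
      rcases he with h | h
      · exact ⟨_, h, rfl⟩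
      · exact ⟨_, h, Sym2.eq_swap⟩
  refine ⟨place, arc, place_injective, fun u v huv => isPolygonalArc_segment
    (place_injective.ne huv.ne), fun e he w hw => ?_, fun e he f hf hef x hx => ?_⟩
  · obtain ⟨a, ha, rfl⟩ := hedge e he
    exact Sym2.mem_iff.mpr (eq_of_place_mem_segment ha hw)
  · obtain ⟨a, ha, rfl⟩ := hedge e he
    obtain ⟨b, hb, rfl⟩ := hedge f hf
    obtain ⟨w, h1, h2, rfl⟩ := eq_place_of_mem_segments ha hb hef hx.1 hx.2
    exact ⟨w, ⟨Sym2.mem_iff.mpr h1, Sym2.mem_iff.mpr h2⟩, rfl⟩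

theorem six_le_egirth_subdividedTournament :
    (6 : ℕ) ≤ subdividedTournament.underlying.egirth := by
  set G := subdividedTournament.underlying with hG
  -- The graph is bipartite, so closed walks of lengths 3 and 5 are excluded outright; length 4
  -- needs the walk not to backtrack.
  have hdec3 : ∀ a b, G.Adj a b → ∀ c, G.Adj b c → ¬ G.Adj c a := by decide +kernel
  have hdec4 : ∀ a b, G.Adj a b → ∀ c, G.Adj b c → c ≠ a → ∀ d, G.Adj c d → d ≠ b →
      ¬ G.Adj d a := by decide +kernel
  have hdec5 : ∀ a b, G.Adj a b → ∀ c, G.Adj b c → ∀ d, G.Adj c d → ∀ e, G.Adj d e →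
      ¬ G.Adj e a := by decide +kernel
  rw [SimpleGraph.le_egirth]
  intro a w hw
  by_contra hlt
  rw [not_le, Nat.cast_lt] at hlt
  have h3 := hw.three_le_length
  have hadj : ∀ i, i < w.length → G.Adj (w.getVert i) (w.getVert (i + 1)) :=
    fun _ hi => w.adj_getVert_succ hi
  have hback : ∀ i, i + 2 ≤ w.length → w.getVert (i + 2) ≠ w.getVert i := by
    intro i hi h
    exact hw.getVert_sub_one_ne_getVert_add_one (i := i + 1) (by omega) h.symm
  have hlast : w.getVert w.length = w.getVert 0 := by simp
  rcases (show w.length = 3 ∨ w.length = 4 ∨ w.length = 5 by omega) with h | h | h <;>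
    rw [h] at hlast hadj hback
  · exact hdec3 _ _ (hadj 0 (by omega)) _ (hadj 1 (by omega)) (hlast ▸ hadj 2 (by omega))
  · exact hdec4 _ _ (hadj 0 (by omega)) _ (hadj 1 (by omega)) (hback 0 (by omega)) _
      (hadj 2 (by omega)) (hback 1 (by omega)) (hlast ▸ hadj 3 (by omega))
  · exact hdec5 _ _ (hadj 0 (by omega)) _ (hadj 1 (by omega)) _ (hadj 2 (by omega)) _
      (hadj 3 (by omega)) (hlast ▸ hadj 4 (by omega))

/-- Every oriented graph on at most three vertices maps to the Cayley digraph of `ZMod 6` with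
connection set `{1, 2}`. -/
theorem exists_potential {n : ℕ} (hn : n ≤ 3) (H : OrientedGraph (Fin n)) :
    ∃ f : Fin n → ZMod 6, ∀ i j, H.Adj i j → f j - f i = 1 ∨ f j - f i = 2 := by
  classical
  -- Transitive triangles take consecutive residues such as 0, 1, 2; cyclic ones take 0, 2, 4.
  have key : ∀ p q r : Bool, ∃ x y z : ZMod 6,
      (if p then y - x = 1 ∨ y - x = 2 else x - y = 1 ∨ x - y = 2) ∧
      (if q then z - y = 1 ∨ z - y = 2 else y - z = 1 ∨ y - z = 2) ∧
      (if r then z - x = 1 ∨ z - x = 2 else x - z = 1 ∨ x - z = 2) := by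
    decide +kernel
  -- Extending the arc relation by false to all naturals treats `n < 3` uniformly; missing arcs are
  -- oriented arbitrarily by `decide`.
  obtain ⟨R, hR⟩ : ∃ R : ℕ → ℕ → Prop, ∀ a b, R a b ↔
    ∃ (ha : a < n) (hb : b < n), H.Adj ⟨a, ha⟩ ⟨b, hb⟩ := ⟨_, fun _ _ => Iff.rfl⟩
  have hasymm : ∀ a b, R a b → ¬ R b a := by
    intro a b h h'
    obtain ⟨_, _, h⟩ := (hR a b).mp h
    obtain ⟨_, _, h'⟩ := (hR b a).mp h'
    exact H.asymm _ _ h h'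
  obtain ⟨x, y, z, h1, h2, h3⟩ := key (decide (R 0 1)) (decide (R 1 2)) (decide (R 0 2))
  obtain ⟨f, f0, f1, f2⟩ : ∃ f : ℕ → ZMod 6, f 0 = x ∧ f 1 = y ∧ f 2 = z :=
    ⟨fun a => if a = 0 then x else if a = 1 then y else z, rfl, rfl, rfl⟩
  have hfR : ∀ a < 3, ∀ b < 3, R a b → f b - f a = 1 ∨ f b - f a = 2 := by
    intro a ha b hb hab
    have hba := hasymm a b hab
    have hne : a ≠ b := fun h => by subst h; exact hba hab
    interval_cases a <;> interval_cases b <;> simp only [f0, f1, f2] <;> first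
      | exact (hne rfl).elim
      | simpa only [hab, hba, decide_true, decide_false, if_true, Bool.false_eq_true,
          if_false] using h1
      | simpa only [hab, hba, decide_true, decide_false, if_true, Bool.false_eq_true,
          if_false] using h2
      | simpa only [hab, hba, decide_true, decide_false, if_true, Bool.false_eq_true,
          if_false] using h3
  exact ⟨fun i => f i, fun i j hij => hfR i (by omega) j (by omega)
    ((hR i j).mpr ⟨i.2, j.2, hij⟩)⟩

theorem four_le_chiP_subdividedTournament : 4 ≤ subdividedTournament.chiP := by
  by_contra hlt
  have hmem := Nat.sInf_mem (s := {n : ℕ | ∃ (H : OrientedGraph (Fin n)) (φ : Fin 10 → Fin n),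
    subdividedTournament.IsPushHom H φ})
    -- The identity makes the set nonempty, so that the infimum is attained and is not the default
    -- value 0.
    ⟨10, subdividedTournament, id, _, Relation.ReflTransGen.refl, fun _ _ h => h⟩
  obtain ⟨H, φ, O', hO', hφ⟩ := hmem
  obtain ⟨s, rfl⟩ := OrientedGraph.exists_eq_pushAll_of_pushRel hO'
  obtain ⟨f, hf⟩ := exists_potential (by
    have : subdividedTournament.chiP ≤ 3 := by omega
    exact this) H
  classical
  -- Shifting pushed vertices by 3 undoes the push: a reversed arc has difference `-d + 3`, and this
  -- map exchanges 1 and 2.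
  set κ : Fin 10 → ZMod 6 := fun v => f (φ v) + if s v then 3 else 0 with hκ
  have hshift : ∀ d : ZMod 6, d = 1 ∨ d = 2 → -d + 3 = 1 ∨ -d + 3 = 2 := by decide
  have hthree : (3 : ZMod 6) = -3 := by decide
  have harc : ∀ u v, (u, v) ∈ subdividedArcs → κ v - κ u = 1 ∨ κ v - κ u = 2 := by
    intro u v huv
    by_cases hs : s u ↔ s v
    · have := hf _ _ (hφ u v (Or.inl ⟨hs, huv⟩))
      have e : κ v - κ u = f (φ v) - f (φ u) := by
        simp only [hκ, hs]; ring
      rwa [e]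
    · have := hshift _ (hf _ _ (hφ v u (Or.inr ⟨fun h => hs h.symm, huv⟩)))
      have e : κ v - κ u = -(f (φ u) - f (φ v)) + 3 := by
        simp only [hκ]
        by_cases hu : s u
        · have hv : ¬ s v := fun hv => hs (by simp [hu, hv])
          simp only [hu, hv, if_true, if_false]
          linear_combination -hthree
        · have hv : s v := by by_contra hv; exact hs (by simp [hu, hv])
          simp only [hu, hv, if_true, if_false]
          ring
      rwa [e]
  have hpath : ∀ x y z : ZMod 6, (y - x = 1 ∨ y - x = 2) → (z - y = 1 ∨ z - y = 2) →
      z - x = 2 ∨ z - x = 3 ∨ z - x = 4 := by decide +kernel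
  -- Differences 2, 3, 4 mean cyclic distance at least 2, a symmetric relation; a 6-cycle has no
  -- four vertices pairwise so far apart.
  have hnone : ∀ a b c d : ZMod 6, (b - a = 2 ∨ b - a = 3 ∨ b - a = 4) →
      (c - a = 2 ∨ c - a = 3 ∨ c - a = 4) → (d - a = 2 ∨ d - a = 3 ∨ d - a = 4) →
      (c - b = 2 ∨ c - b = 3 ∨ c - b = 4) → (d - c = 2 ∨ d - c = 3 ∨ d - c = 4) →
      ¬ (b - d = 2 ∨ b - d = 3 ∨ b - d = 4) := by decide +kernel
  exact hnone (κ 0) (κ 1) (κ 2) (κ 3)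
    (hpath _ _ _ (harc 0 4 (by decide)) (harc 4 1 (by decide)))
    (hpath _ _ _ (harc 0 5 (by decide)) (harc 5 2 (by decide)))
    (hpath _ _ _ (harc 0 6 (by decide)) (harc 6 3 (by decide)))
    (hpath _ _ _ (harc 1 7 (by decide)) (harc 7 2 (by decide)))
    (hpath _ _ _ (harc 2 8 (by decide)) (harc 8 3 (by decide)))
    (hpath _ _ _ (harc 3 9 (by decide)) (harc 9 1 (by decide)))

theorem planarGirthAtLeast_subdividedTournament :
    PlanarGirthAtLeast 6 subdividedTournament.underlying :=
  ⟨inferInstance, isPlanar_subdividedTournament, six_le_egirth_subdividedTournament⟩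

theorem four_le_chiP_underlying : 4 ≤ chiP subdividedTournament.underlying := by
  -- The upper bound 7 is needed here: it makes the supremum over orientations one of a bounded set.
  refine four_le_chiP_subdividedTournament.trans (le_csSup ⟨7, ?_⟩ ⟨_, rfl, rfl⟩)
  rintro _ ⟨O, hO, rfl⟩
  exact chiP_orientation_le planarGirthAtLeast_subdividedTournament hO

end PushColoring

theorem theorem6 :
    ∃ m : ℕ, PushColoring.IsFamilyChiP (PushColoring.PlanarGirthAtLeast 6) m ∧ 4 ≤ m ∧ m ≤ 7 := by
  set S : Set ℕ := {k | ∃ (V : Type) (G : SimpleGraph V),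
    PushColoring.PlanarGirthAtLeast 6 G ∧ PushColoring.chiP G = k} with hS
  have hbound : ∀ k ∈ S, k ≤ 7 := by
    rintro _ ⟨V, G, hG, rfl⟩
    exact PushColoring.chiP_le_seven hG
  have hmem : PushColoring.chiP PushColoring.subdividedTournament.underlying ∈ S :=
    ⟨_, _, PushColoring.planarGirthAtLeast_subdividedTournament, rfl⟩
  have hbdd : BddAbove S := ⟨7, hbound⟩
  have hmax := Nat.sSup_mem ⟨_, hmem⟩ hbdd
  exact ⟨sSup S, ⟨hmax, fun k hk => le_csSup hbdd hk⟩,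
    PushColoring.four_le_chiP_underlying.trans (le_csSup hbdd hmem), hbound _ hmax⟩
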